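/- Let $d\ge 1$. A matrix $R\in\mathbb{R}^{d\times d}$ is called completely-$\mathcal{S}$ if for every principal submatrix $\tilde R$ of $R$ there is a vector $w\ge 0$ with $\tilde R w>0$ (coordinatewise). Given a continuous path $x:[0,\infty)\to\mathbb{R}^d$, a solution of the Skorokhod problem with input $x$ and reflection matrix $R$ is a pair of continuous functions $y,z:[0,\infty)\to\mathbb{R}^d_+$ such that $z(t)=x(t)+Ry(t)$ for all $t\ge 0$; $y(0)=0$ and every coordinate $y_j$ is non-decreasing; and $\int_0^\infty z_j(s)\,dy_j(s)=0$ (Stieltjes integral) for $j=1,\dots,d$. For $z_0\in\mathbb{R}^d_+$ and $\theta\in\mathbb{R}^d$ the fluid model $(z_0,\theta,R)$ is called stable if every solution $(y,z)$ of the Skorokhod problem with input $x(t)=z_0+\theta t$ satisfies $\lim_{t\to\infty}z(t)=0$. **Theorem.** Stability of a fluid model is algorithmically undecidable: there is no algorithm (partial recursive function) which, given an arbitrary dimension $d\ge 1$, vectors $z_0\in\mathbb{Q}^d_+$, $\theta\in\mathbb{Q}^d$ and a completely-$\mathcal{S}$ matrix $R\in\mathbb{Q}^{d\times d}$ (each rational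 entry being given by its numerator and denominator), terminates and outputs YES if $(z_0,\theta,R)$ is stable and NO otherwise. -/

import Mathlib

open Filter Topology MeasureTheory
open scoped NNReal ENNReal

namespace Skorokhod

/-- A square matrix `M` is an `S`-matrix if there is a vector `w ≥ 0` with `M w > 0`,
both inequalities being coordinatewise. -/
def IsSMatrix {ι : Type*} [Fintype ι] (M : Matrix ι ι ℝ) : Prop :=
  ∃ w : ι → ℝ, (∀ i, 0 ≤ w i) ∧ ∀ i, 0 < M.mulVec w i

/-- A square matrix is completely-`S` if each of its (nonempty) principal submatrices is an
`S`-matrix. -/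
def IsCompletelyS {d : ℕ} (R : Matrix (Fin d) (Fin d) ℝ) : Prop :=
  ∀ I : Finset (Fin d), I.Nonempty →
    IsSMatrix (R.submatrix (fun i : I => (i : Fin d)) (fun i : I => (i : Fin d)))

/-- A continuous nondecreasing function on `[0, ∞)`, as a Stieltjes function. -/
def toStieltjes (g : ℝ≥0 → ℝ) (hm : Monotone g) (hc : Continuous g) : StieltjesFunction ℝ≥0 where
  toFun := g
  mono' := hm
  right_continuous' := fun _ => hc.continuousWithinAt

/-- `(y, z)` is a solution of the Skorokhod problem on the nonnegative orthant with input path `x`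
and reflection matrix `R`: `y` and `z` are continuous paths in the nonnegative orthant,
`z = x + R y`, `y(0) = 0`, every `y_j` is nondecreasing, and the Stieltjes integral
`∫_0^∞ z_j dy_j` vanishes for every `j`. The integrand is nonnegative, so that the integral is
taken as an extended nonnegative number, with no integrability condition. -/
structure IsSolution {d : ℕ} (x : ℝ≥0 → Fin d → ℝ) (R : Matrix (Fin d) (Fin d) ℝ)
    (y z : ℝ≥0 → Fin d → ℝ) : Prop where
  continuous_y : ∀ j, Continuous fun t => y t j
  continuous_z : ∀ j, Continuous fun t => z t j
  nonneg_y : ∀ t j, 0 ≤ y t j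
  nonneg_z : ∀ t j, 0 ≤ z t j
  eq_add : ∀ t, z t = x t + R.mulVec (y t)
  zero_y : y 0 = 0
  monotone_y : ∀ j, Monotone fun t => y t j
  integral_eq_zero : ∀ j,
    ∫⁻ s, ENNReal.ofReal (z s j)
      ∂(toStieltjes (fun t => y t j) (monotone_y j) (continuous_y j)).measure = 0

/-- The fluid model `(z₀, θ, R)` is stable if `z(t) → 0` as `t → ∞` for every solution `(y, z)` of
the Skorokhod problem with input path `x(t) = z₀ + θ t`. -/
def IsStable {d : ℕ} (z₀ θ : Fin d → ℝ) (R : Matrix (Fin d) (Fin d) ℝ) : Prop :=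
  ∀ y z : ℝ≥0 → Fin d → ℝ,
    IsSolution (fun t => z₀ + (t : ℝ) • θ) R y z → Tendsto z atTop (𝓝 0)

/-- A rational number as a finite object: its reduced numerator and denominator. -/
def encodeRat (q : ℚ) : ℤ × ℕ := (q.num, q.den)

/-- The type of the inputs of an algorithm: a list for `z₀`, a list for `θ`, and the list of the
rows of `R`, the entries being given by numerator and denominator. -/
abbrev Input : Type := List (ℤ × ℕ) × List (ℤ × ℕ) × List (List (ℤ × ℕ))

/-- The finite description of a `d`-dimensional fluid model with rational data. The dimension
can be read off from it, as the length of the lists. -/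
def encodeModel {d : ℕ} (z₀ θ : Fin d → ℚ) (R : Matrix (Fin d) (Fin d) ℚ) : Input :=
  (List.ofFn fun i => encodeRat (z₀ i),
   List.ofFn fun i => encodeRat (θ i),
   List.ofFn fun i => List.ofFn fun j => encodeRat (R i j))

/-- The (possibly partial) procedure `f` decides stability: on the description of every fluid model
`(z₀, θ, R)`, in any dimension `d ≥ 1`, with rational data, `z₀ ≥ 0` and `R` completely-`S`, it terminates
with the answer `true` if the model is stable and with the answer `false` otherwise. Nothing is
required of `f` on other inputs. -/
def DecidesStability (f : Input →. Bool) : Prop :=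
  ∀ (d : ℕ) (z₀ θ : Fin d → ℚ) (R : Matrix (Fin d) (Fin d) ℚ),
    1 ≤ d → (∀ i, 0 ≤ z₀ i) → IsCompletelyS (R.map fun q : ℚ => (q : ℝ)) →
      (IsStable (fun i => (z₀ i : ℝ)) (fun i => (θ i : ℝ)) (R.map fun q : ℚ => (q : ℝ)) →
        true ∈ f (encodeModel z₀ θ R)) ∧
      (¬ IsStable (fun i => (z₀ i : ℝ)) (fun i => (θ i : ℝ)) (R.map fun q : ℚ => (q : ℝ)) →
        false ∈ f (encodeModel z₀ θ R))

end Skorokhod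

/-! The halting problem reduces to stability, with `d`, `R` and `θ = (-1, …, -1)` fixed and only
`z₀` depending on the instance. Since `R` has unit diagonal, a coordinate `p` that alone sits at `0`
and pushes does so at rate `1`, and every coordinate `i` moves with velocity `R i p - 1`. The model
is thus a piecewise linear machine that switches when a coordinate reaches `0`. Sign conditions on
the entries between vanishing coordinates (`Phase`) force this motion for every solution
(`ReflectedPath.eq_of_phase`); conversely, infinitely many phases of infinite total duration glue to
a solution (`exists_isSolution_of_phases`).

A stack is stored as a decimal number with digits at most `4`, multiplied by a scale `s`. A node of
the program is five phases (`Program.Transition.run`). `A` and `B` push while the register is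
drained, for a time affine in its content `ξ`, and the levels `M m` change meanwhile by amounts
affine in `ξ`. Then all `M m` sink together, and the first to reach `0` selects the edge `m`. Up to
terms common to all digits, the level for the digit `k` is `k² s - 20 k ξ`, that is `s (k - 10 ξ /
s)²`: the digit nearest to `10 ξ / s` wins, and this is the top digit because the remaining fraction
is at most `4/9`. The other `M` keep offsets that depend on `ξ`; draining the copy of `ξ` in the
temporary register at a second node cancels them, and the stack operation, an affine map of `ξ`, is
performed on the way back (`transition_fst`, `transition_snd`, `run_step`).

A Turing machine with stacks for a universal partial recursive function is simulated in this way. If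
it never halts, the scale stays constant and a solution returns forever to states having coordinates
equal to `s` (`not_isStable`). If it halts, the program clears its stacks and enters a loop that
halves the scale and doubles a counter. A round takes at least counter times scale, a quantity that
the loop preserves, so infinitely many rounds fill all time and every solution tends to `0`
(`isStable`). Without the growing counter the round times would be summable, and nothing would
control solutions after they reach the origin.

Negative entries of `R` respect a ranking of the coordinates, which gives complete-`S`
(`isCompletelyS_of_rank`). The instance `n` is fed in as `2 ^ n - 1`, a block of equal binary
digits, so that `z₀` is an explicit primitive recursive integer vector. -/

namespace Skorokhod

/-! ### Reflected paths with drift `-1` -/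

/-- The consequences of the Skorokhod equations with input `z₀ - t • 1` that determine the
evolution of a path: the increments of `z`, and the fact that `y i` only grows when `z i = 0`. -/
structure ReflectedPath {ι : Type*} [Fintype ι] (R : Matrix ι ι ℝ) (y z : ℝ → ι → ℝ) : Prop where
  continuous_y : ∀ i, Continuous fun t => y t i
  continuous_z : ∀ i, Continuous fun t => z t i
  monotone_y : ∀ i, Monotone fun t => y t i
  nonneg_z : ∀ t i, 0 ≤ z t i
  increment : ∀ s t, 0 ≤ s → s ≤ t → ∀ i,
    z t i = z s i - (t - s) + ∑ j, R i j * (y t j - y s j)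
  flat : ∀ i a b, 0 ≤ a → a ≤ b → (∀ r ∈ Set.Ioc a b, 0 < z r i) → y b i = y a i

/-- `Phase R p u u' τ` says that from `u` the path can move for the time `τ` with the single
boundary coordinate `p` pushing, and reaches `u'`; the conditions on the other coordinates that
vanish at `u` ensure that this is the only possible motion. -/
structure Phase {ι : Type*} (R : Matrix ι ι ℝ) (p : ι) (u u' : ι → ℝ) (τ : ℝ) : Prop where
  time_nonneg : 0 ≤ τ
  nonneg : ∀ i, 0 ≤ u i
  nonneg' : ∀ i, 0 ≤ u' i
  active : u p = 0
  move : ∀ i, u' i = u i + τ * (R i p - 1)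
  row : ∀ i, i ≠ p → u i = 0 → R p i ≤ 0
  col : ∀ i, i ≠ p → u i = 0 → 1 ≤ R i p
  block : ∀ i j, i ≠ p → j ≠ p → u i = 0 → u j = 0 → 0 ≤ R i j

theorem exists_last_nonpos {h : ℝ → ℝ} (hc : Continuous h) {a r : ℝ} (har : a ≤ r)
    (ha : h a ≤ 0) :
    ∃ c, a ≤ c ∧ c ≤ r ∧ h c ≤ 0 ∧ ∀ u ∈ Set.Ioc c r, 0 < h u := by
  have hK : IsCompact (Set.Icc a r ∩ {u | h u ≤ 0}) :=
    isCompact_Icc.inter_right (isClosed_le hc continuous_const)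
  obtain ⟨c, hcK, hmax⟩ := hK.exists_isGreatest ⟨a, ⟨le_refl a, har⟩, ha⟩
  refine ⟨c, hcK.1.1, hcK.1.2, hcK.2, fun u hu => ?_⟩
  by_contra hneg
  exact absurd (hmax ⟨⟨hcK.1.1.trans hu.1.le, hu.2⟩, not_lt.1 hneg⟩) (not_le.2 hu.1)

namespace ReflectedPath

variable {ι : Type*} [Fintype ι] {R : Matrix ι ι ℝ} {y z : ℝ → ι → ℝ}

/-- After the last time at which `y i` has its initial value, `z i` dominates a positive quantity,
and then `flat` forbids any growth of `y i`. -/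
theorem eq_of_increment_le (h : ReflectedPath R y z) {i : ι} {a b : ℝ} (ha : 0 ≤ a)
    (hz : ∀ r ∈ Set.Icc a b, y r i - y a i ≤ z r i) {r : ℝ} (hr : r ∈ Set.Icc a b) :
    y r i = y a i := by
  by_contra hne
  have hlt : 0 < y r i - y a i :=
    sub_pos.2 (lt_of_le_of_ne (h.monotone_y i hr.1) (Ne.symm hne))
  obtain ⟨c, hac, hcr, hc, hpos⟩ := exists_last_nonpos
    (h := fun u => y u i - y a i) ((h.continuous_y i).sub continuous_const) hr.1 (by simp)
  have := h.flat i c r (ha.trans hac) hcr fun u hu =>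
    (hpos u hu).trans_le (hz u ⟨hac.trans hu.1.le, hu.2.trans hr.2⟩)
  simp only [this] at hlt
  exact absurd hc (not_le.2 hlt)

/-- Positive coordinates do not push. The condition `row` makes `p` push at least at rate `1`; then
`col` and `block` lift the other vanishing coordinates enough to keep them from pushing. What
remains is one-dimensional reflection at `p`. -/
theorem y_eq_of_pos [DecidableEq ι] (h : ReflectedPath R y z) (hdiag : ∀ i, R i i = 1) {p : ι}
    {u u' : ι → ℝ} {τ : ℝ} (hP : Phase R p u u' τ) {t₀ : ℝ} (ht₀ : 0 ≤ t₀) (hz : z t₀ = u) {b : ℝ}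
    (hpos : ∀ i, i ≠ p → u i ≠ 0 → ∀ r ∈ Set.Ioc t₀ b, 0 < z r i) {r : ℝ}
    (hr : r ∈ Set.Icc t₀ b) (i : ι) :
    y r i - y t₀ i = if i = p then r - t₀ else 0 := by
  have hO : ∀ i, i ≠ p → u i ≠ 0 → ∀ r ∈ Set.Icc t₀ b, y r i - y t₀ i = 0 :=
    fun i hip hi r hr => sub_eq_zero.2 <| h.flat i t₀ r ht₀ hr.1 fun v hv =>
      hpos i hip hi v ⟨hv.1, hv.2.trans hr.2⟩
  have hmono : ∀ i, ∀ r ∈ Set.Icc t₀ b, 0 ≤ y r i - y t₀ i :=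
    fun i r hr => sub_nonneg.2 (h.monotone_y i hr.1)
  have hp1 : ∀ r ∈ Set.Icc t₀ b, r - t₀ ≤ y r p - y t₀ p := by
    intro r hr
    have h1 := h.increment t₀ r ht₀ hr.1 p
    rw [hz, hP.active, ← Finset.add_sum_erase _ _ (Finset.mem_univ p), hdiag p] at h1
    have h2 : ∑ j ∈ Finset.univ.erase p, R p j * (y r j - y t₀ j) ≤ 0 := by
      refine Finset.sum_nonpos fun j hj => ?_
      have hjp := Finset.ne_of_mem_erase hj
      by_cases hj0 : u j = 0
      · exact mul_nonpos_of_nonpos_of_nonneg (hP.row j hjp hj0) (hmono j r hr)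
      · rw [hO j hjp hj0 r hr, mul_zero]
    have h3 := h.nonneg_z r p
    linarith
  have hN : ∀ i, i ≠ p → ∀ r ∈ Set.Icc t₀ b, y r i - y t₀ i = 0 := by
    intro i hip r hr
    by_cases hi : u i = 0
    -- The push of `p` compensates the drift in row `i`, so `z i` is at least the growth of `y i`.
    · refine sub_eq_zero.2 (h.eq_of_increment_le ht₀ (fun r hr => ?_) hr)
      have h1 := h.increment t₀ r ht₀ hr.1 i
      rw [hz, hi, ← Finset.add_sum_erase _ _ (Finset.mem_univ p),
        ← Finset.add_sum_erase _ _ (Finset.mem_erase.2 ⟨hip, Finset.mem_univ i⟩), hdiag i] at h1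
      have h2 : 0 ≤ ∑ j ∈ (Finset.univ.erase p).erase i, R i j * (y r j - y t₀ j) := by
        refine Finset.sum_nonneg fun j hj => ?_
        have hjp := Finset.ne_of_mem_erase (Finset.mem_of_mem_erase hj)
        by_cases hj0 : u j = 0
        · exact mul_nonneg (hP.block i j hip hjp hi hj0) (hmono j r hr)
        · rw [hO j hjp hj0 r hr, mul_zero]
      have h3 : r - t₀ ≤ R i p * (y r p - y t₀ p) := by
        have := hp1 r hr
        have h4 := hP.col i hip hi
        have h5 := hmono p r hr
        nlinarith
      linarith
    · exact hO i hip hi r hr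
  have hzp : ∀ r ∈ Set.Icc t₀ b, z r p = -(r - t₀) + (y r p - y t₀ p) := by
    intro r hr
    have h1 := h.increment t₀ r ht₀ hr.1 p
    rw [hz, hP.active, ← Finset.add_sum_erase _ _ (Finset.mem_univ p), hdiag p,
      Finset.sum_eq_zero fun j hj => by
        rw [hN j (Finset.ne_of_mem_erase hj) r hr, mul_zero]] at h1
    linarith
  split_ifs with hip
  · subst hip
    by_contra hne
    have h0 : 0 < z r i := by
      have h1 := hzp r hr
      have h2 := hp1 r hr
      rcases h2.lt_or_eq with h3 | h3
      · linarith
      · exact absurd h3.symm hne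
    obtain ⟨c, hac, hcr, hc, hpos'⟩ := exists_last_nonpos
      (h := fun u => z u i) (h.continuous_z i) hr.1 (by rw [hz]; exact hP.active.le)
    have h1 := h.flat i c r (ht₀.trans hac) hcr hpos'
    have h2 := hzp r hr
    have h3 := hzp c ⟨hac, hcr.trans hr.2⟩
    have h4 := h.nonneg_z c i
    linarith
  · exact hN i hip r hr

theorem z_eq_of_pos [DecidableEq ι] (h : ReflectedPath R y z) (hdiag : ∀ i, R i i = 1) {p : ι}
    {u u' : ι → ℝ} {τ : ℝ} (hP : Phase R p u u' τ) {t₀ : ℝ} (ht₀ : 0 ≤ t₀) (hz : z t₀ = u) {b : ℝ}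
    (hpos : ∀ i, i ≠ p → u i ≠ 0 → ∀ r ∈ Set.Ioc t₀ b, 0 < z r i) {r : ℝ}
    (hr : r ∈ Set.Icc t₀ b) (i : ι) :
    z r i = u i + (r - t₀) * (R i p - 1) := by
  rw [h.increment t₀ r ht₀ hr.1 i, hz]
  simp only [h.y_eq_of_pos hdiag hP ht₀ hz hpos hr, mul_ite, mul_zero, Finset.sum_ite_eq',
    Finset.mem_univ, if_true]
  ring

/-- During a phase the path is forced. -/
theorem eq_of_phase (h : ReflectedPath R y z) (hdiag : ∀ i, R i i = 1) {p : ι}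
    {u u' : ι → ℝ} {τ : ℝ} (hP : Phase R p u u' τ) {t₀ : ℝ} (ht₀ : 0 ≤ t₀) (hz : z t₀ = u) {r : ℝ}
    (hr : r ∈ Set.Icc t₀ (t₀ + τ)) (i : ι) :
    z r i = u i + (r - t₀) * (R i p - 1) := by
  classical
  have hlin : ∀ i, u i ≠ 0 → ∀ r ∈ Set.Ico t₀ (t₀ + τ), 0 < u i + (r - t₀) * (R i p - 1) := by
    intro i hi r hr
    have h1 : 0 < u i := lt_of_le_of_ne (hP.nonneg i) (Ne.symm hi)
    have h2 := hP.move i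
    have h3 := hP.nonneg' i
    have hr1 := hr.1
    have hr2 := hr.2
    by_cases hs : 0 ≤ R i p - 1
    · have := mul_nonneg (sub_nonneg.2 hr1) hs
      linarith
    · push Not at hs
      nlinarith
  have hpos : ∀ i, i ≠ p → u i ≠ 0 → ∀ r ∈ Set.Ico t₀ (t₀ + τ), 0 < z r i := by
    by_contra hcon
    push Not at hcon
    obtain ⟨i₀, hip₀, hi₀, r₀, hr₀, hz₀⟩ := hcon
    -- Consider the first time `c` at which an initially positive coordinate vanishes. Before `c`
    -- the motion is linear, hence by continuity also at `c`, where the linear formula is still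
    -- positive.
    have hK : IsCompact (Set.Icc t₀ r₀ ∩ ⋃ i ∈ {i | i ≠ p ∧ u i ≠ 0}, {v | z v i ≤ 0}) :=
      isCompact_Icc.inter_right <| (Set.toFinite _).isClosed_biUnion fun i _ =>
        isClosed_le (h.continuous_z i) continuous_const
    obtain ⟨c, ⟨hcI, hcU⟩, hmin⟩ := hK.exists_isLeast ⟨r₀, ⟨hr₀.1, le_refl _⟩,
      Set.mem_biUnion (show i₀ ∈ {i | i ≠ p ∧ u i ≠ 0} from ⟨hip₀, hi₀⟩) hz₀⟩
    obtain ⟨i, ⟨hip, hi⟩, hci⟩ := Set.mem_iUnion₂.1 hcU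
    simp only [Set.mem_ofPred_eq] at hci
    have hc0 : t₀ < c := by
      refine lt_of_le_of_ne hcI.1 fun hcc => ?_
      rw [← hcc, hz] at hci
      exact hi (le_antisymm hci (hP.nonneg i))
    have hbefore : ∀ r ∈ Set.Ico t₀ c, z r i = u i + (r - t₀) * (R i p - 1) := by
      intro r hr
      refine h.z_eq_of_pos hdiag hP ht₀ hz (b := r) (fun j hjp hj v hv => ?_) ⟨hr.1, le_refl _⟩ i
      by_contra hneg
      exact absurd (hmin ⟨⟨hv.1.le, (hv.2.trans hr.2.le).trans hcI.2⟩,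
        Set.mem_biUnion (show j ∈ {i | i ≠ p ∧ u i ≠ 0} from ⟨hjp, hj⟩) (not_lt.1 hneg)⟩)
        (not_le.2 (hv.2.trans_lt hr.2))
    have hcl : Set.EqOn (fun r => z r i) (fun r => u i + (r - t₀) * (R i p - 1))
        (closure (Set.Ico t₀ c)) :=
      Set.EqOn.closure hbefore (h.continuous_z i) (by fun_prop)
    have h1 := hcl (by rw [closure_Ico hc0.ne]; exact ⟨hc0.le, le_refl c⟩)
    have h2 := hlin i hi c ⟨hc0.le, hcI.2.trans_lt hr₀.2⟩
    simp only at h1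
    linarith
  have hIco : ∀ r ∈ Set.Ico t₀ (t₀ + τ), z r i = u i + (r - t₀) * (R i p - 1) := fun r hr =>
    h.z_eq_of_pos hdiag hP ht₀ hz (b := r)
      (fun j hjp hj v hv => hpos j hjp hj v ⟨hv.1.le, hv.2.trans_lt hr.2⟩) ⟨hr.1, le_refl _⟩ i
  rcases hP.time_nonneg.eq_or_lt with h0 | h0
  · have : r = t₀ := le_antisymm (by simpa [← h0] using hr.2) hr.1
    subst this
    rw [hz]; ring
  · have hcl : Set.EqOn (fun r => z r i) (fun r => u i + (r - t₀) * (R i p - 1))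
        (closure (Set.Ico t₀ (t₀ + τ))) :=
      Set.EqOn.closure hIco (h.continuous_z i) (by fun_prop)
    exact hcl (by rw [closure_Ico (by linarith)]; exact hr)

end ReflectedPath

/-- `Run R B n u T u'`: a sequence of `n` phases leads from `u` to `u'` in the time `T`, through
states with coordinates at most `B`. -/
inductive Run {ι : Type*} (R : Matrix ι ι ℝ) (B : ℝ) : ℕ → (ι → ℝ) → ℝ → (ι → ℝ) → Prop
  | refl (u : ι → ℝ) : (∀ i, u i ≤ B) → Run R B 0 u 0 u
  | step {u u' u'' : ι → ℝ} {τ T : ℝ} {n : ℕ} (p : ι) : (∀ i, u i ≤ B) → Phase R p u u' τ →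
      Run R B n u' T u'' → Run R B (n + 1) u (τ + T) u''

namespace Run

variable {ι : Type*} {R : Matrix ι ι ℝ} {B B' : ℝ} {n n' : ℕ}

theorem bound_left {u u' : ι → ℝ} {T : ℝ} (hR : Run R B n u T u') (i : ι) : u i ≤ B := by
  cases hR with
  | refl _ h => exact h i
  | step _ h _ _ => exact h i

theorem time_nonneg {u u' : ι → ℝ} {T : ℝ} (hR : Run R B n u T u') : 0 ≤ T := by
  induction hR with
  | refl => exact le_refl _
  | step p _ hP _ ih => exact add_nonneg hP.time_nonneg ih

theorem trans {u u' u'' : ι → ℝ} {T T' : ℝ} (h : Run R B n u T u') (h' : Run R B n' u' T' u'') :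
    Run R B (n + n') u (T + T') u'' := by
  induction h with
  | refl => rwa [zero_add, zero_add]
  | @step _ _ _ τ T _ p hb hP _ ih =>
    rw [Nat.add_right_comm, add_assoc τ T T']; exact .step p hb hP (ih h')

theorem exists_phases [Nonempty ι] {u u' : ι → ℝ} {T : ℝ} (h : Run R B n u T u') :
    ∃ (p : ℕ → ι) (v : ℕ → ι → ℝ) (τ : ℕ → ℝ), v 0 = u ∧ v n = u' ∧
      (∀ i < n, Phase R (p i) (v i) (v (i + 1)) (τ i)) ∧ ∑ i ∈ Finset.range n, τ i = T := by
  induction h with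
  | refl u _ =>
    exact ⟨fun _ => Classical.arbitrary ι, fun _ => u, fun _ => 0, rfl, rfl, by simp, by simp⟩
  | @step u u' u'' σ T n p hb hP _ ih =>
    obtain ⟨q, v, τ, h0, hn, hph, hT⟩ := ih
    refine ⟨fun i => Nat.casesOn i p q, fun i => Nat.casesOn i u v, fun i => Nat.casesOn i σ τ,
      rfl, hn, fun i hi => ?_, ?_⟩
    · rcases i with _ | i
      · simpa [h0] using hP
      · exact hph i (by omega)
    · rw [Finset.sum_range_succ']
      simp only [hT]
      exact add_comm _ _

end Run

/-- Along a run the path is forced. -/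
theorem ReflectedPath.eq_of_run {ι : Type*} [Fintype ι] {R : Matrix ι ι ℝ} {y z : ℝ → ι → ℝ}
    (h : ReflectedPath R y z) (hdiag : ∀ i, R i i = 1) {u u' : ι → ℝ} {B T : ℝ}
    {n : ℕ} (hR : Run R B n u T u') : ∀ {t₀ : ℝ}, 0 ≤ t₀ → z t₀ = u →
      z (t₀ + T) = u' ∧ ∀ r ∈ Set.Icc t₀ (t₀ + T), ∀ i, z r i ≤ B := by
  induction hR with
  | refl u hb =>
    intro t₀ _ hz
    refine ⟨by rwa [add_zero], fun r hr i => ?_⟩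
    have : r = t₀ := le_antisymm (by simpa using hr.2) hr.1
    rw [this, hz]; exact hb i
  | @step u u' u'' τ T n p hb hP hR ih =>
    intro t₀ ht₀ hz
    have hτ := hP.time_nonneg
    have key : ∀ r ∈ Set.Icc t₀ (t₀ + τ), ∀ i, z r i = u i + (r - t₀) * (R i p - 1) :=
      fun r hr i => h.eq_of_phase hdiag hP ht₀ hz hr i
    have hend : z (t₀ + τ) = u' := by
      funext i
      rw [key _ ⟨by linarith, le_refl _⟩ i, hP.move i]; ring
    obtain ⟨h1, h2⟩ := ih (t₀ := t₀ + τ) (by linarith) hend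
    refine ⟨by rw [← add_assoc]; exact h1, fun r hr i => ?_⟩
    by_cases hrt : r ≤ t₀ + τ
    · rw [key r ⟨hr.1, hrt⟩ i]
      have hu := hb i
      have hu' := hR.bound_left i
      rw [hP.move i] at hu'
      have hr1 := hr.1
      -- Within a phase the motion is affine, so a bound at both ends holds in between.
      by_cases hs : 0 ≤ R i p - 1
      · nlinarith
      · push Not at hs
        nlinarith
    · exact h2 r ⟨by linarith, by linarith [hr.2]⟩ i

/-! ### Reindexing -/

theorem Phase.reindex {ι κ : Type*} {R : Matrix ι ι ℝ} {p : ι} {u u' : ι → ℝ} {τ : ℝ}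
    (h : Phase R p u u' τ) (e : ι ≃ κ) :
    Phase (R.submatrix e.symm e.symm) (e p) (u ∘ e.symm) (u' ∘ e.symm) τ where
  time_nonneg := h.time_nonneg
  nonneg i := h.nonneg _
  nonneg' i := h.nonneg' _
  active := by simpa using h.active
  move i := by simpa using h.move (e.symm i)
  row i hi h0 := by
    simpa using h.row (e.symm i) (fun hh => hi ((Equiv.symm_apply_eq e).1 hh)) h0
  col i hi h0 := by
    simpa using h.col (e.symm i) (fun hh => hi ((Equiv.symm_apply_eq e).1 hh)) h0
  block i j hi hj h0 h0' := h.block (e.symm i) (e.symm j)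
    (fun hh => hi ((Equiv.symm_apply_eq e).1 hh)) (fun hh => hj ((Equiv.symm_apply_eq e).1 hh)) h0 h0'

theorem Run.reindex {ι κ : Type*} {R : Matrix ι ι ℝ} {B : ℝ} {u u' : ι → ℝ} {T : ℝ}
    {n : ℕ} (h : Run R B n u T u') (e : ι ≃ κ) :
    Run (R.submatrix e.symm e.symm) B n (u ∘ e.symm) T (u' ∘ e.symm) := by
  induction h with
  | refl _ h => exact .refl _ fun i => h _
  | step p hb hP _ ih => exact .step (e p) (fun i => hb _) (hP.reindex e) ih

/-! ### Solutions are reflected paths -/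

theorem IsSolution.reflectedPath {d : ℕ} {z₀ : Fin d → ℝ} {R : Matrix (Fin d) (Fin d) ℝ}
    {y z : ℝ≥0 → Fin d → ℝ} (h : IsSolution (fun t => z₀ + (t : ℝ) • fun _ => -1) R y z) :
    ReflectedPath R (fun t => y t.toNNReal) (fun t => z t.toNNReal) where
  continuous_y i := (h.continuous_y i).comp continuous_real_toNNReal
  continuous_z i := (h.continuous_z i).comp continuous_real_toNNReal
  monotone_y i _ _ hab := h.monotone_y i (Real.toNNReal_mono hab)
  nonneg_z t i := h.nonneg_z _ i
  increment s t hs hst i := by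
    have h1 := congrFun (h.eq_add t.toNNReal) i
    have h2 := congrFun (h.eq_add s.toNNReal) i
    simp only [Pi.add_apply, Pi.smul_apply, smul_eq_mul, Real.coe_toNNReal _ hs,
      Real.coe_toNNReal _ (hs.trans hst), Matrix.mulVec, dotProduct] at h1 h2
    simp only [mul_sub, Finset.sum_sub_distrib]
    linarith
  flat i a b ha hab hpos := by
    have h0 := h.integral_eq_zero i
    set f := toStieltjes (fun t => y t i) (h.monotone_y i) (h.continuous_y i)
    have hcont : Continuous fun s : ℝ≥0 => ENNReal.ofReal (z s i) :=
      ENNReal.continuous_ofReal.comp (h.continuous_z i)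
    rw [lintegral_eq_zero_iff hcont.measurable] at h0
    -- The vanishing integral says that `{z i > 0}` is null for `dy i`, and the measure of the
    -- interval is the increment of `y i`.
    have h1 : f.measure (Set.Ioc a.toNNReal b.toNNReal) = 0 := by
      refine measure_mono_null (fun s hs => ?_) h0
      have hs1 : a < (s : ℝ) := by
        have := NNReal.coe_lt_coe.2 hs.1
        rwa [Real.coe_toNNReal _ ha] at this
      have hs2 : (s : ℝ) ≤ b := by
        have := NNReal.coe_le_coe.2 hs.2
        rwa [Real.coe_toNNReal _ (ha.trans hab)] at this
      have := hpos s ⟨hs1, hs2⟩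
      rw [Real.toNNReal_coe] at this
      simpa using this
    rw [StieltjesFunction.measure_Ioc, ENNReal.ofReal_eq_zero] at h1
    have h2 : y b.toNNReal i - y a.toNNReal i ≤ 0 := h1
    exact le_antisymm (by linarith) (h.monotone_y i (Real.toNNReal_mono hab))

/-! ### Gluing an infinite sequence of phases -/

section Glue

variable {d : ℕ} (p : ℕ → Fin d) (τ : ℕ → ℝ)

/-- The starting time of the `n`-th phase. -/
noncomputable def startTime (n : ℕ) : ℝ := ∑ m ∈ Finset.range n, τ m

/-- The pushing done up to time `t` in the first `N` phases. -/
noncomputable def partialPush (N : ℕ) (t : ℝ) (i : Fin d) : ℝ :=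
  ∑ n ∈ Finset.range N,
    if p n = i then min t (startTime τ (n + 1)) - min t (startTime τ n) else 0

variable {p τ}

theorem startTime_succ (n : ℕ) : startTime τ (n + 1) = startTime τ n + τ n :=
  Finset.sum_range_succ _ _

theorem startTime_mono (hτ : ∀ n, 0 ≤ τ n) : Monotone (startTime τ) :=
  monotone_nat_of_le_succ fun n => by rw [startTime_succ]; linarith [hτ n]

theorem startTime_nonneg (hτ : ∀ n, 0 ≤ τ n) (n : ℕ) : 0 ≤ startTime τ n :=
  Finset.sum_nonneg fun _ _ => hτ _

/-- Phases that start after `t` contribute nothing; hence the limit in `N` is locally a finite sum.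
-/
theorem partialPush_eq (hτ : ∀ n, 0 ≤ τ n) {N M : ℕ} {t : ℝ} (hNM : N ≤ M)
    (ht : t ≤ startTime τ N) (i : Fin d) : partialPush p τ M t i = partialPush p τ N t i := by
  refine (Finset.sum_subset (Finset.range_mono hNM) fun n _ hn => ?_).symm
  have hn' : N ≤ n := not_lt.1 fun h => hn (Finset.mem_range.2 h)
  rw [min_eq_left (ht.trans (startTime_mono hτ hn')),
    min_eq_left (ht.trans (startTime_mono hτ (hn'.trans n.le_succ))), sub_self, ite_self]

theorem partialPush_mono (hτ : ∀ n, 0 ≤ τ n) (N : ℕ) (i : Fin d) :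
    Monotone fun t => partialPush p τ N t i := by
  intro a b hab
  refine Finset.sum_le_sum fun n _ => ?_
  split_ifs
  · have := startTime_mono hτ n.le_succ
    rcases min_cases a (startTime τ (n + 1)) with h1 | h1 <;>
    rcases min_cases a (startTime τ n) with h2 | h2 <;>
    rcases min_cases b (startTime τ (n + 1)) with h3 | h3 <;>
    rcases min_cases b (startTime τ n) with h4 | h4 <;> linarith
  · exact le_refl _

theorem continuous_partialPush (N : ℕ) (i : Fin d) :
    Continuous fun t => partialPush p τ N t i := by
  refine continuous_finsetSum _ fun n _ => ?_
  split_ifs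
  · fun_prop
  · fun_prop

theorem partialPush_piece (hτ : ∀ n, 0 ≤ τ n) {n : ℕ} {t : ℝ} (h1 : startTime τ n ≤ t)
    (h2 : t ≤ startTime τ (n + 1)) (i : Fin d) :
    partialPush p τ (n + 1) t i =
      partialPush p τ n (startTime τ n) i + if p n = i then t - startTime τ n else 0 := by
  rw [partialPush, Finset.sum_range_succ, min_eq_left h2, min_eq_right h1, partialPush]
  congr 1
  refine Finset.sum_congr rfl fun m hm => ?_
  have hm' := Finset.mem_range.1 hm
  have h3 := startTime_mono hτ hm'.le
  have h4 := startTime_mono hτ (Nat.succ_le_of_lt hm')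
  simp only [Nat.succ_eq_add_one] at h4
  rw [min_eq_right (h3.trans h1), min_eq_right (h4.trans h1), min_eq_right h3, min_eq_right h4]

/-- An infinite sequence of phases of infinite total duration is realized by a solution. -/
theorem exists_isSolution_of_phases {R : Matrix (Fin d) (Fin d) ℝ} (hdiag : ∀ i, R i i = 1)
    {u : ℕ → Fin d → ℝ} (hP : ∀ n, Phase R (p n) (u n) (u (n + 1)) (τ n))
    (hT : Tendsto (startTime τ) atTop atTop) :
    ∃ y z, IsSolution (fun t => u 0 + (t : ℝ) • fun _ => -1) R y z ∧
      ∀ n, z (startTime τ n).toNNReal = u n := by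
  have hτ : ∀ n, 0 ≤ τ n := fun n => (hP n).time_nonneg
  have hex : ∀ t : ℝ, ∃ N, t ≤ startTime τ N := fun t => (hT.eventually_ge_atTop t).exists
  choose N hN using hex
  set Y : ℝ → Fin d → ℝ := fun t i => partialPush p τ (N t) t i with hY
  have hYeq : ∀ M t i, t ≤ startTime τ M → Y t i = partialPush p τ M t i := by
    intro M t i hM
    rcases le_total M (N t) with h | h
    · exact partialPush_eq hτ h hM i
    · exact (partialPush_eq hτ h (hN t) i).symm
  have hYcont : ∀ i, Continuous fun t => Y t i := by
    intro i
    refine continuous_iff_continuousAt.2 fun t => ?_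
    refine ((continuous_partialPush (p := p) (τ := τ) (N (t + 1)) i).continuousAt (x := t)).congr ?_
    filter_upwards [eventually_le_nhds (show t < t + 1 by linarith)] with s hs
    exact (hYeq _ _ _ (hs.trans (hN (t + 1)))).symm
  have hYmono : ∀ i, Monotone fun t => Y t i := by
    intro i a b hab
    simp only
    rw [hYeq (N b) a i (hab.trans (hN b)), hYeq (N b) b i (hN b)]
    exact partialPush_mono hτ _ i hab
  have hYpiece : ∀ n t i, startTime τ n ≤ t → t ≤ startTime τ (n + 1) →
      Y t i = Y (startTime τ n) i + if p n = i then t - startTime τ n else 0 := by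
    intro n t i h1 h2
    rw [hYeq (n + 1) t i h2, hYeq n _ i (le_refl _), partialPush_piece hτ h1 h2]
  have hY0 : ∀ i, Y 0 i = 0 := fun i => by
    rw [hYeq 0 0 i (startTime_nonneg hτ 0)]; simp [partialPush]
  set Z : ℝ → Fin d → ℝ := fun t i => u 0 i - t + ∑ j, R i j * Y t j with hZ
  have hZstep : ∀ n t i, startTime τ n ≤ t → t ≤ startTime τ (n + 1) →
      Z t i = Z (startTime τ n) i + (t - startTime τ n) * (R i (p n) - 1) := by
    intro n t i h1 h2
    simp only [hZ, hYpiece n t _ h1 h2, mul_add, Finset.sum_add_distrib, mul_ite, mul_zero,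
      Finset.sum_ite_eq, Finset.mem_univ, if_true]
    ring
  have hZu : ∀ n i, Z (startTime τ n) i = u n i := by
    intro n i
    induction n with
    | zero => simp [hZ, startTime, hY0]
    | succ n ih =>
      rw [hZstep n _ i (startTime_mono hτ n.le_succ) (le_refl _), ih, (hP n).move i,
        startTime_succ]
      ring
  have hZpiece : ∀ n t i, startTime τ n ≤ t → t ≤ startTime τ (n + 1) →
      Z t i = u n i + (t - startTime τ n) * (R i (p n) - 1) := by
    intro n t i h1 h2
    rw [hZstep n t i h1 h2, hZu]
  have hloc : ∀ t : ℝ, 0 < t → ∃ n, startTime τ n < t ∧ t ≤ startTime τ (n + 1) := by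
    intro t ht
    have hexx : ∃ M, t ≤ startTime τ M := ⟨N t, hN t⟩
    classical
    obtain ⟨n, hn⟩ : ∃ n, Nat.find hexx = n + 1 := by
      refine Nat.exists_eq_succ_of_ne_zero fun h0 => ?_
      have := Nat.find_spec hexx
      rw [h0] at this
      simp only [startTime, Finset.range_zero, Finset.sum_empty] at this
      linarith
    exact ⟨n, not_le.1 (Nat.find_min hexx (by omega)), hn ▸ Nat.find_spec hexx⟩
  have hZnonneg : ∀ t i, 0 ≤ t → 0 ≤ Z t i := by
    intro t i ht
    rcases ht.eq_or_lt with h0 | h0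
    · have := hZu 0 i
      simp only [startTime, Finset.range_zero, Finset.sum_empty] at this
      rw [← h0, this]
      exact (hP 0).nonneg i
    · obtain ⟨n, hn1, hn2⟩ := hloc t h0
      rw [hZpiece n t i hn1.le hn2]
      have h1 := (hP n).nonneg i
      have h2 := (hP n).nonneg' i
      rw [(hP n).move i] at h2
      rw [startTime_succ] at hn2
      by_cases hs : 0 ≤ R i (p n) - 1
      · nlinarith
      · push Not at hs
        nlinarith
  have hZcont : ∀ i, Continuous fun t => Z t i := fun i =>
    (continuous_const.sub continuous_id).add
      (continuous_finsetSum _ fun j _ => continuous_const.mul (hYcont j))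
  refine ⟨fun t => Y t, fun t => Z t, ?_, fun n => ?_⟩
  · refine
      { continuous_y := fun i => (hYcont i).comp NNReal.continuous_coe
        continuous_z := fun i => (hZcont i).comp NNReal.continuous_coe
        nonneg_y := fun t i => ?_
        nonneg_z := fun t i => hZnonneg t i t.2
        eq_add := fun t => ?_
        zero_y := ?_
        monotone_y := fun i a b hab => hYmono i (NNReal.coe_le_coe.2 hab)
        integral_eq_zero := fun i => ?_ }
    · rw [← hY0 i]; exact hYmono i t.2
    · funext i
      simp only [hZ, Pi.add_apply, Pi.smul_apply, smul_eq_mul, Matrix.mulVec, dotProduct]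
      ring
    · funext i
      simpa using hY0 i
    · refine lintegral_eq_zero_of_ae_eq_zero ?_
      set f := toStieltjes (fun t : ℝ≥0 => Y t i)
        (fun a b hab => hYmono i (NNReal.coe_le_coe.2 hab)) ((hYcont i).comp NNReal.continuous_coe)
      -- The measure `dy i` only charges the phases in which `i` pushes, and there `z i = 0`. There
      -- is no atom at `0`, because the left limit at the least element is the value itself.
      have hnull : f.measure ({0} ∪ ⋃ n ∈ {n | p n ≠ i},
          Set.Ioc (startTime τ n).toNNReal (startTime τ (n + 1)).toNNReal) = 0 := by
        rw [measure_union_null_iff]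
        refine ⟨?_, (measure_biUnion_null_iff (Set.to_countable _)).2 fun n hn => ?_⟩
        · rw [StieltjesFunction.measure_singleton,
            leftLim_eq_of_isBot (fun _ => zero_le), sub_self, ENNReal.ofReal_zero]
        · have hn' : p n ≠ i := hn
          rw [StieltjesFunction.measure_Ioc, ENNReal.ofReal_eq_zero]
          change Y _ i - Y _ i ≤ 0
          rw [Real.coe_toNNReal _ (startTime_nonneg hτ _),
            Real.coe_toNNReal _ (startTime_nonneg hτ _),
            hYpiece n _ i (startTime_mono hτ n.le_succ) (le_refl _), if_neg hn']
          linarith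
      refine measure_mono_null (fun s hs => ?_) hnull
      by_contra hsn
      simp only [Set.mem_union, Set.mem_singleton_iff, Set.mem_iUnion, not_or, not_exists] at hsn
      obtain ⟨hs0, hsn⟩ := hsn
      have hspos : (0 : ℝ) < s := NNReal.coe_pos.2 (pos_iff_ne_zero.2 hs0)
      obtain ⟨n, hn1, hn2⟩ := hloc s hspos
      have hp : p n = i := by
        by_contra hne
        refine hsn n hne ⟨?_, ?_⟩
        · rw [← NNReal.coe_lt_coe, Real.coe_toNNReal _ (startTime_nonneg hτ _)]; exact hn1
        · rw [← NNReal.coe_le_coe, Real.coe_toNNReal _ (startTime_nonneg hτ _)]; exact hn2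
      have hzero : Z s i = 0 := by
        rw [hZpiece n s i hn1.le hn2, ← hp, (hP n).active, hdiag]
        simp
      exact hs (show ENNReal.ofReal (Z s i) = 0 by rw [hzero, ENNReal.ofReal_zero])
  · funext i
    simp only [Real.coe_toNNReal _ (startTime_nonneg hτ _), hZu]

/-- An infinite sequence of runs of equal lengths, whose durations are bounded from below, is
realized by a solution. -/
theorem exists_isSolution_of_runs {R : Matrix (Fin d) (Fin d) ℝ} (hdiag : ∀ i, R i i = 1)
    {u : ℕ → Fin d → ℝ} {B c : ℝ} {k : ℕ} {T : ℕ → ℝ} (hc : 0 < c) (hT : ∀ n, c ≤ T n)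
    (hR : ∀ n, Run R B k (u n) (T n) (u (n + 1))) :
    ∃ y z, IsSolution (fun t => u 0 + (t : ℝ) • fun _ => -1) R y z ∧
      ∀ N : ℕ, ∃ n ≥ N, ∃ t : ℝ≥0, (N : ℝ≥0) ≤ t ∧ z t = u n := by
  have hk : 0 < k := by
    rcases Nat.eq_zero_or_pos k with rfl | hk
    · have := hR 0
      have h0 := hT 0
      generalize T 0 = T₀ at this h0
      generalize u 0 = a, u (0 + 1) = b at this
      cases this
      linarith
    · exact hk
  have hne : Nonempty (Fin d) := by
    have := hR 0
    obtain ⟨k, rfl⟩ := Nat.exists_eq_succ_of_ne_zero hk.ne'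
    generalize T 0 = T₀, u 0 = a, u (0 + 1) = b at this
    cases this with
    | step p _ _ _ => exact ⟨p⟩
  choose p v τ hv0 hvk hph hsum using fun n => (hR n).exists_phases
  -- As all runs have the same length `k`, phase `n` of the concatenation is phase `n % k` of run `n
  -- / k`.
  set q : ℕ → Fin d := fun n => p (n / k) (n % k) with hq
  set w : ℕ → Fin d → ℝ := fun n => v (n / k) (n % k) with hw
  set σ : ℕ → ℝ := fun n => τ (n / k) (n % k) with hσ
  have hw0 : ∀ n, w (k * n) = u n := fun n => by
    simp [hw, hk, hv0]
  have hphase : ∀ n, Phase R (q n) (w n) (w (n + 1)) (σ n) := by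
    intro n
    have h1 := hph (n / k) (n % k) (Nat.mod_lt _ hk)
    have h2 : w (n + 1) = v (n / k) (n % k + 1) := by
      by_cases h : n % k + 1 = k
      · have hn : n + 1 = k * (n / k + 1) := by
          have := Nat.div_add_mod n k
          rw [mul_add]; omega
        rw [hn, hw0, h, hvk]
      · have hlt : n % k + 1 < k := lt_of_le_of_ne (Nat.mod_lt _ hk) h
        have hdm := Nat.div_add_mod n k
        have hd : (n + 1) / k = n / k := by
          rw [← hdm, add_assoc, Nat.mul_add_div hk, Nat.div_eq_of_lt hlt, Nat.mul_add_div hk,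
            Nat.div_eq_of_lt (Nat.mod_lt _ hk)]
        have hm : (n + 1) % k = n % k + 1 := by
          conv_lhs => rw [← hdm, add_assoc, Nat.mul_add_mod]
          exact Nat.mod_eq_of_lt hlt
        simp only [hw, hd, hm]
    rw [h2]; exact h1
  have hστ : ∀ n, 0 ≤ σ n := fun n => (hphase n).time_nonneg
  have hstart : ∀ n : ℕ, n * c ≤ startTime σ (k * n) := by
    intro n
    induction n with
    | zero => simp [startTime]
    | succ n ih =>
      have h1 : startTime σ (k * (n + 1)) = startTime σ (k * n) + T n := by
        rw [startTime, mul_add, mul_one, Finset.sum_range_add, ← startTime, ← hsum n]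
        congr 1
        refine Finset.sum_congr rfl fun i hi => ?_
        have hi' := Finset.mem_range.1 hi
        simp only [hσ]
        rw [Nat.mul_add_div hk, Nat.div_eq_of_lt hi', Nat.mul_add_mod, Nat.mod_eq_of_lt hi',
          add_zero]
      rw [h1]
      push_cast
      linarith [hT n]
  have hunb : ∀ b : ℝ, ∃ n, b ≤ startTime σ (k * n) := fun b => by
    obtain ⟨n, hn⟩ := exists_nat_ge (b / c)
    exact ⟨n, ((div_le_iff₀ hc).1 hn).trans (hstart n)⟩
  have htend : Tendsto (startTime σ) atTop atTop :=
    tendsto_atTop_atTop.2 fun b => by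
      obtain ⟨n, hn⟩ := hunb b
      exact ⟨k * n, fun m hm => hn.trans (startTime_mono hστ hm)⟩
  obtain ⟨y, z, hsol, hz⟩ := exists_isSolution_of_phases hdiag hphase htend
  refine ⟨y, z, ?_, fun N => ?_⟩
  · have : w 0 = u 0 := by simpa using hw0 0
    rwa [this] at hsol
  · obtain ⟨n, hn⟩ := hunb N
    refine ⟨max n N, le_max_right _ _, (startTime σ (k * max n N)).toNNReal, ?_, ?_⟩
    · rw [← NNReal.coe_le_coe, Real.coe_toNNReal _ (startTime_nonneg hστ _)]
      exact hn.trans (startTime_mono hστ (Nat.mul_le_mul_left _ (le_max_left _ _)))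
    · rw [hz, hw0]

end Glue

/-! ### Completely-`S` matrices -/

/-- A matrix with positive diagonal whose negative entries respect a ranking of the indices is
completely-`S`. -/
theorem isCompletelyS_of_rank {d : ℕ} {R : Matrix (Fin d) (Fin d) ℝ} (ρ : Fin d → ℕ)
    (hdiag : ∀ i, R i i = 1) (hneg : ∀ i j, R i j < 0 → ρ j < ρ i) : IsCompletelyS R := by
  obtain ⟨C, hC1, hC⟩ : ∃ C : ℝ, 1 ≤ C ∧ ∀ i, ∑ j, |R i j| < C := by
    refine ⟨1 + ∑ i, ∑ j, |R i j|, ?_, fun i => ?_⟩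
    · have : 0 ≤ ∑ i, ∑ j, |R i j| :=
        Finset.sum_nonneg fun i _ => Finset.sum_nonneg fun j _ => abs_nonneg _
      linarith
    · have : ∑ j, |R i j| ≤ ∑ i, ∑ j, |R i j| :=
        Finset.single_le_sum (f := fun i => ∑ j, |R i j|)
          (fun i _ => Finset.sum_nonneg fun j _ => abs_nonneg _) (Finset.mem_univ i)
      linarith
  have hC0 : 0 < C := by linarith
  intro I _
  -- Since `C` exceeds every absolute row sum and a negative entry of row `i` meets a weight of at
  -- most `C ^ ρ i / C`, the diagonal term wins.
  refine ⟨fun i => C ^ ρ i, fun i => by positivity, fun i => ?_⟩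
  simp only [Matrix.mulVec, dotProduct, Matrix.submatrix_apply]
  rw [Finset.sum_coe_sort I (fun j => R i j * C ^ ρ j), ← Finset.add_sum_erase _ _ i.2, hdiag,
    one_mul]
  have hterm : ∀ j, -(|R i j| * (C ^ ρ i / C)) ≤ R i j * C ^ ρ j := by
    intro j
    by_cases h : R i j < 0
    · have hlt := hneg _ _ h
      have : C ^ ρ j ≤ C ^ ρ i / C := by
        rw [le_div_iff₀ hC0, ← pow_succ]
        exact pow_le_pow_right₀ hC1 hlt
      rw [abs_of_neg h]
      nlinarith
    · push Not at h
      have h1 : 0 ≤ R i j * C ^ ρ j := by positivity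
      have h2 : 0 ≤ |R i j| * (C ^ ρ i / C) := by positivity
      linarith
  have h1 : -((∑ j ∈ I.erase i, |R i j|) * (C ^ ρ i / C)) ≤ ∑ j ∈ I.erase i, R i j * C ^ ρ j := by
    rw [Finset.sum_mul, ← Finset.sum_neg_distrib]
    exact Finset.sum_le_sum fun j _ => hterm j
  have h2 : ∑ j ∈ I.erase i, |R i j| < C :=
    (Finset.sum_le_univ_sum_of_nonneg fun j => abs_nonneg _).trans_lt (hC i)
  have h3 : (∑ j ∈ I.erase i, |R i j|) * (C ^ ρ i / C) < C ^ ρ (i : Fin d) := by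
    calc _ < C * (C ^ ρ i / C) := by gcongr
      _ = _ := by field_simp
  linarith

open Turing.PartrecToTM2 (Γ' K')

/-! ### Stack programs -/

/-- What a stack program does to the stack that it has inspected: the action `halve` leaves the
stack unchanged and halves the scale of the fluid model that simulates the program. -/
inductive Act
  | push (a : Γ')
  | pop
  | keep
  | halve

/-- A program on the stacks `K'`: at the label `l` the top symbol `d` of the stack `stk l` is
inspected, the action `act l d` is applied to this stack, and the control moves to `nxt l d`. -/
structure Program (Λ : Type) where
  stk : Λ → K'
  act : Λ → Option Γ' → Act
  nxt : Λ → Option Γ' → Λ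

/-- The digit that encodes the top of a stack. -/
def digit : Option Γ' → ℕ
  | none => 0
  | some .consₗ => 1
  | some .cons => 2
  | some .bit0 => 3
  | some .bit1 => 4

theorem digit_injective : Function.Injective digit := by
  intro a b h
  rcases a with _ | (_ | _ | _ | _) <;> rcases b with _ | (_ | _ | _ | _) <;>
    simp_all [digit]

theorem digit_le (a : Option Γ') : digit a ≤ 4 := by
  rcases a with _ | (_ | _ | _ | _) <;> simp [digit]

namespace Act

/-- An action replaces the content `ξ` at scale `s` by `factor * ξ + shift * s`: a push gives `(a s
+ ξ) / 10`, a pop `10 ξ - d s`. -/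
def factor : Act → ℚ
  | push _ => 1 / 10
  | pop => 10
  | keep => 1
  | halve => 1 / 2

def shift : Act → Option Γ' → ℚ
  | push a, _ => digit (some a) / 10
  | pop, d => -digit d
  | keep, _ => 0
  | halve, _ => 0

def scale : Act → ℚ
  | halve => 1 / 2
  | _ => 1

theorem scale_pos (a : Act) : 0 < a.scale := by cases a <;> norm_num [scale]

theorem scale_le_one (a : Act) : a.scale ≤ 1 := by cases a <;> norm_num [scale]

theorem factor_nonneg (a : Act) : 0 ≤ a.factor := by cases a <;> norm_num [factor]

theorem factor_le (a : Act) : a.factor ≤ 10 := by cases a <;> norm_num [factor]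

end Act

/-! ### The fluid model of a program -/

/-- Each label is treated in two steps: `fst l` moves the inspected stack to the temporary register
and determines its top symbol `d`, then `snd l d` moves it back. -/
inductive Node (Λ : Type)
  | fst (l : Λ)
  | snd (l : Λ) (d : Option Γ')
  deriving DecidableEq, Fintype

/-- `fst l d` leads from the node `fst l` to `snd l d`, and `snd l d` from there to the next
label. -/
inductive Edge (Λ : Type)
  | fst (l : Λ) (d : Option Γ')
  | snd (l : Λ) (d : Option Γ')
  deriving DecidableEq, Fintype

instance : Fintype K' := ⟨{.main, .rev, .aux, .stack}, fun k => by cases k <;> simp⟩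

/-- The coordinates of the fluid model. At a node `q` the coordinates `A q`, `B q`, `X (reg q)`,
`M e` for the chosen edge `e`, and `W` are, in this order, the pushing ones. The registers are the
stacks and the temporary register `none`. -/
inductive Coord (Λ : Type)
  | A (q : Node Λ)
  | B (q : Node Λ)
  | M (e : Edge Λ)
  | X (j : Option K')
  | W
  deriving DecidableEq, Fintype

namespace Program

variable {Λ : Type} (P : Program Λ)

def src : Edge Λ → Node Λ
  | .fst l _ => .fst l
  | .snd l d => .snd l d

theorem src_fst (l : Λ) (d : Option Γ') : src (.fst l d) = .fst l := rfl

theorem src_snd (l : Λ) (d : Option Γ') : src (.snd l d) = .snd l d := rfl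

def dst : Edge Λ → Node Λ
  | .fst l d => .snd l d
  | .snd l d => .fst (P.nxt l d)

def scale : Edge Λ → ℚ
  | .fst _ _ => 1
  | .snd l d => (P.act l d).scale

/-- The register that is emptied at a node. -/
def reg : Node Λ → Option K'
  | .fst l => some (P.stk l)
  | .snd _ _ => none

/-- The rate of filling a register while the register `reg q` is emptied. -/
def gain : Node Λ → Option K' → ℚ
  | .fst _, j => if j = none then 1 else 0
  | .snd l d, j => if j = some (P.stk l) then (P.act l d).factor else 0

/-- The values solve `Transition.fill`. Registers carry a margin of twice the scale, and draining
lasts `ξ + s` instead of `ξ`; `refill` restores the margin at the new scale, removes the excess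
`gain * s` and adds the shift of the action. -/
def refill : Edge Λ → Option K' → ℚ
  | .fst l _, j => if j = some (P.stk l) then 2 else if j = none then -1 else 0
  | .snd l d, j =>
    if j = none then 2 * (P.act l d).scale
    else if j = some (P.stk l) then
      (P.act l d).shift d - (P.act l d).factor + 2 * (P.act l d).scale - 2
    else 2 * (P.act l d).scale - 2

theorem gain_nonneg (q : Node Λ) (j : Option K') : 0 ≤ P.gain q j := by
  cases q <;> simp only [gain] <;> split_ifs <;> simp [Act.factor_nonneg]

theorem gain_le (q : Node Λ) (j : Option K') : P.gain q j ≤ 10 := by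
  cases q <;> simp only [gain] <;> split_ifs <;> norm_num [Act.factor_le]

theorem scale_pos (e : Edge Λ) : 0 < P.scale e := by
  cases e <;> simp [scale, Act.scale_pos]

theorem scale_le_one (e : Edge Λ) : P.scale e ≤ 1 := by
  cases e <;> simp [scale, Act.scale_le_one]

variable [DecidableEq Λ]

/-- The constant terms of the lines whose minimum determines the top symbol. -/
def height (l : Λ) : Edge Λ → ℚ
  | .fst l' d => if l' = l then (digit d : ℚ) ^ 2 else 96
  | .snd _ _ => 96

/-- The negatives of the slopes of the lines whose minimum determines the top symbol. -/
def slope (l : Λ) : Edge Λ → ℚ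
  | .fst l' d => if l' = l then 20 * (digit d : ℚ) else 0
  | .snd _ _ => 0

/-- Chosen so that, together with `tiltB`, the compared values become `lines`; the slope enters here
to offset the extra time `s` of draining. The constant `96 = 4² + 20 * 4` is the least one for which
the selected edge has tilt at most `-1` for every digit, as the sign condition `row` requires; as
the height of foreign edges it puts their line at `0` at a node `fst l`. The tilts of `snd l d` undo
the offsets left by `fst l`, and the last indicator keeps foreign edges at least `s` above the
chosen one. -/
def tiltA : Node Λ → Edge Λ → ℚ
  | .fst l, m => -(if src m = .fst l then 1 else 0) - 96 + height l m + slope l m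
  | .snd l d, m => (digit d : ℚ) ^ 2 - height l m + 20 * digit d - slope l m -
      (if src m = .snd l d then 1 else 0)

def tiltB : Node Λ → Edge Λ → ℚ
  | .fst l, m => -1 - slope l m
  | .snd l d, m => -1 - (20 * digit d - slope l m)

/-- The entry of the reflection matrix in the row `i` and the column `p`, minus `1`: the velocity of
the coordinate `i` while `p` is the only pushing coordinate. -/
def drift : Coord Λ → Coord Λ → ℚ
  | .A q, .M e => P.scale e * (1 + if q = P.dst e then 0 else 1) - if q = src e then 0 else 1
  | .A _, .W => -1
  | .A _, _ => 0
  | .B q, .A q' => if q = q' then -1 else 0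
  | .B q, .M e => P.scale e - if q = src e then 0 else 1
  | .B _, _ => 0
  | .M m, .A q => tiltA q m
  | .M m, .B q => tiltB q m
  | .M _, .X _ => -1
  | .M m, .M e => if src m = src e then 0 else -1
  | .M _, .W => 200
  | .X j, .A q => if j = P.reg q then -1 else 0
  | .X j, .B q => if j = P.reg q then -1 else P.gain q j
  | .X j, .M e => P.refill e j
  | .X _, _ => 0
  | .W, .A _ => 1
  | .W, .M _ => -1
  | .W, _ => 0

/-- The reflection matrix. -/
def matrixQ : Matrix (Coord Λ) (Coord Λ) ℚ := fun i p => 1 + P.drift i p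

def matrix : Matrix (Coord Λ) (Coord Λ) ℝ := P.matrixQ.map (↑)

theorem matrix_diag (i : Coord Λ) : P.matrix i i = 1 := by
  rcases i with q | q | m | j | _ <;> simp [matrix, matrixQ, drift]

/-- The coordinates with negative entries only in columns of lower rank. -/
def rank : Coord Λ → ℕ
  | .X _ => 2
  | .M _ => 1
  | _ => 0

/-- Negative entries can only occur in rows `M` against columns `A`, `B`, and in rows `X` against
columns `M`. -/
theorem rank_lt_of_neg (i p : Coord Λ) (h : P.matrix i p < 0) : rank p < rank i := by
  have h' : P.matrixQ i p < 0 := by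
    have : ((P.matrixQ i p : ℚ) : ℝ) < 0 := h
    exact_mod_cast this
  revert h'
  rcases i with q | q | m | j | _ <;> rcases p with q' | q' | e | j' | _ <;>
    simp only [matrixQ, drift, rank] <;> intro h' <;> try norm_num
  all_goals exfalso; revert h'; rw [imp_false, not_lt]
  all_goals try norm_num
  all_goals first
    | (have := P.scale_pos e
       split_ifs <;> nlinarith)
    | (split_ifs <;> norm_num)

end Program

/-- A state of the fluid model. -/
def assemble {Λ : Type} (a b : Node Λ → ℝ) (m : Edge Λ → ℝ) (x : Option K' → ℝ) (w : ℝ) :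
    Coord Λ → ℝ
  | .A q => a q
  | .B q => b q
  | .M e => m e
  | .X j => x j
  | .W => w

/-- The state at the arrival in the node `q`, with the scale `s` and the register contents `x`. -/
def hub {Λ : Type} [DecidableEq Λ] (q : Node Λ) (s : ℝ) (x : Option K' → ℝ) (h : Edge Λ → ℝ) :
    Coord Λ → ℝ :=
  assemble (fun q' => if q' = q then 0 else s) (fun _ => s) (fun m => 200 * s + h m)
    (fun j => x j + 2 * s) 0

/-! ### The five phases at a node -/

namespace Program

variable {Λ : Type} [DecidableEq Λ] (P : Program Λ)

/-- The numerical conditions under which the fluid model passes from the node `src e` to the node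
`dst e`: the registers `x` become `x'`, the offsets `h` of the coordinates `M` become `h'`, and `l`
are the values that are compared at the node. -/
structure Transition (e : Edge Λ) (s : ℝ) (x x' : Option K' → ℝ) (h h' l : Edge Λ → ℝ) :
    Prop where
  scale_pos : 0 < s
  nonneg : ∀ j, 0 ≤ x j
  nonneg' : ∀ j, 0 ≤ x' j
  le : ∀ j, x j ≤ s
  le' : ∀ j, x' j ≤ s
  line : ∀ m, l m = h m + s * tiltA (src e) m + (x (P.reg (src e)) + s) * (1 + tiltB (src e) m)
  hub_pos : ∀ m, 0 < 200 * s + h m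
  hub_le : ∀ m, 200 * s + h m ≤ 1000 * s
  mid_pos : ∀ m, 0 < 200 * s + h m + s * tiltA (src e) m
  mid_le : ∀ m, 200 * s + h m + s * tiltA (src e) m ≤ 1000 * s
  line_min : ∀ m, m ≠ e → l e < l m
  -- Draining takes at most `2 * s`, so the levels `200 * s - (x + s) + l m` are still at least `s`
  -- when the register is empty: no `M` reaches `0` too early.
  line_ge : -(197 * s) ≤ l e
  line_le : ∀ m, l m ≤ 300 * s
  tiltA_le : tiltA (src e) e ≤ -1
  tiltB_le : tiltB (src e) e ≤ -1
  fill : ∀ j, x' j + 2 * P.scale e * s =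
    (if j = P.reg (src e) then 0 else x j + 2 * s + P.gain (src e) j * (x (P.reg (src e)) + s)) +
      s * P.refill e j
  refill_nonneg : 0 ≤ P.refill e (P.reg (src e))
  offset : ∀ m, h' m = l m - l e - if src m = src e then 0 else s
  offset_nonneg : ∀ m, 0 ≤ h' m

/-- The states of the fluid model at the starts of the five phases at a node, and at their end. -/
def stage (e : Edge Λ) (s : ℝ) (x x' : Option K' → ℝ) (h h' l : Edge Λ → ℝ) :
    ℕ → Coord Λ → ℝ
  | 0 => hub (src e) s x h
  | 1 => assemble (fun q => if q = src e then 0 else s) (fun q => if q = src e then 0 else s)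
      (fun m => 200 * s + h m + s * tiltA (src e) m)
      (fun j => x j + 2 * s - if j = P.reg (src e) then s else 0) s
  | 2 => assemble (fun q => if q = src e then 0 else s) (fun q => if q = src e then 0 else s)
      (fun m => 200 * s - (x (P.reg (src e)) + s) + l m)
      (fun j => if j = P.reg (src e) then 0
        else x j + 2 * s + P.gain (src e) j * (x (P.reg (src e)) + s)) s
  | 3 => assemble (fun q => if q = src e then 0 else s) (fun q => if q = src e then 0 else s)
      (fun m => l m - l e)
      (fun j => if j = P.reg (src e) then 0
        else x j + 2 * s + P.gain (src e) j * (x (P.reg (src e)) + s)) s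
  | 4 => assemble (fun q => P.scale e * s * (1 + if q = P.dst e then 0 else 1))
      (fun _ => P.scale e * s) h' (fun j => x' j + 2 * (P.scale e * s)) 0
  | _ => hub (P.dst e) (P.scale e * s) x' h'

def active (e : Edge Λ) : ℕ → Coord Λ
  | 0 => .A (src e)
  | 1 => .B (src e)
  | 2 => .X (P.reg (src e))
  | 3 => .M e
  | _ => .W

def duration (e : Edge Λ) (s : ℝ) (x : Option K' → ℝ) (l : Edge Λ → ℝ) : ℕ → ℝ
  | 0 => s
  | 1 => x (P.reg (src e)) + s
  | 2 => 200 * s - (x (P.reg (src e)) + s) + l e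
  | 3 => s
  | _ => P.scale e * s

variable {P}

namespace Transition

variable {e : Edge Λ} {s : ℝ} {x x' : Option K' → ℝ} {h h' l : Edge Λ → ℝ}

theorem scale_bounds (ht : P.Transition e s x x' h h' l) :
    0 < (P.scale e : ℝ) * s ∧ (P.scale e : ℝ) * s ≤ s ∧ (0 : ℝ) < P.scale e ∧
      (P.scale e : ℝ) ≤ 1 := by
  have h1 : (0 : ℝ) < P.scale e := by exact_mod_cast P.scale_pos e
  have h2 : (P.scale e : ℝ) ≤ 1 := by exact_mod_cast P.scale_le_one e
  have h3 := ht.scale_pos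
  exact ⟨by positivity, by nlinarith, h1, h2⟩

theorem gain_bounds (ht : P.Transition e s x x' h h' l) (j : Option K') :
    0 ≤ (P.gain (src e) j : ℝ) * (x (P.reg (src e)) + s) ∧
      (P.gain (src e) j : ℝ) * (x (P.reg (src e)) + s) ≤ 20 * s := by
  have h1 : (0 : ℝ) ≤ P.gain (src e) j := by exact_mod_cast P.gain_nonneg _ j
  have h2 : (P.gain (src e) j : ℝ) ≤ 10 := by exact_mod_cast P.gain_le _ j
  have h3 := ht.scale_pos
  have h4 := ht.nonneg (P.reg (src e))
  have h5 := ht.le (P.reg (src e))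
  exact ⟨by positivity, by nlinarith⟩

theorem stage_bounds (ht : P.Transition e s x x' h h' l) (r : ℕ) (i : Coord Λ) :
    0 ≤ P.stage e s x x' h h' l r i ∧ P.stage e s x x' h h' l r i ≤ 1000 * s := by
  have hs := ht.scale_pos
  obtain ⟨hs1, hs2, -, -⟩ := ht.scale_bounds
  have hx0 := ht.nonneg (P.reg (src e))
  have hx1 := ht.le (P.reg (src e))
  have hle := ht.line_ge
  have hmin : ∀ m, l e ≤ l m := fun m => by
    by_cases hm : m = e
    · rw [hm]
    · exact (ht.line_min m hm).le
  rcases r with _ | _ | _ | _ | _ | r <;> rcases i with q | q | m | j | _ <;>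
    simp only [stage, hub, assemble]
  all_goals first
    | (have := ht.hub_pos m; have := ht.hub_le m; have := ht.mid_pos m; have := ht.mid_le m
       have := hmin m; have := ht.line_le m; have := ht.offset_nonneg m
       have h1 := ht.offset m
       split_ifs at h1 <;> constructor <;> linarith)
    | (have := ht.nonneg j; have := ht.nonneg' j; have := ht.le j; have := ht.le' j
       have := ht.gain_bounds j
       try split_ifs
       all_goals constructor <;> linarith)
    | (try split_ifs
       all_goals constructor <;> linarith)

theorem stage_move (ht : P.Transition e s x x' h h' l) {r : ℕ} (hr : r < 5) (i : Coord Λ) :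
    P.stage e s x x' h h' l (r + 1) i =
      P.stage e s x x' h h' l r i +
        P.duration e s x l r * (P.matrix i (P.active e r) - 1) := by
  interval_cases r <;> rcases i with q | q | m | j | _ <;>
    simp only [stage, hub, assemble, duration, active, matrix, matrixQ, drift, Matrix.map_apply,
      Rat.cast_add, Rat.cast_one, add_sub_cancel_left, add_zero, zero_add]
  all_goals push_cast
  all_goals first
    | (have h1 := ht.line m; have h2 := ht.offset m
       split_ifs at h2 <;> simp_all <;> linarith)
    | linear_combination ht.fill j
    | (have h1 := ht.fill j
       split_ifs at h1 ⊢ <;> simp_all <;> linarith)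
    | (try split_ifs
       all_goals push_cast
       all_goals ring)

/-- The coordinates, apart from the pushing one, that can vanish at the start of a phase. -/
def Idle (e : Edge Λ) (i : Coord Λ) : ℕ → Prop
  | 0 => i = .W
  | 1 => i = .A (src e)
  | 2 => i = .A (src e) ∨ i = .B (src e)
  | 3 => i = .A (src e) ∨ i = .B (src e) ∨ i = .X (P.reg (src e))
  | _ => ∃ m, i = .M m

/-- The strict inequality `line_min` excludes a tie: when `M e` reaches `0`, every other `M` is
positive. Only in the last phase may several `M` vanish, and there `W` lifts them all. -/
theorem idle_of_stage_eq_zero (ht : P.Transition e s x x' h h' l) {r : ℕ} (hr : r < 5)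
    {i : Coord Λ} (hi : i ≠ P.active e r) (h0 : P.stage e s x x' h h' l r i = 0) :
    Idle (P := P) e i r := by
  have hs := ht.scale_pos
  obtain ⟨hs1, hs2, -, -⟩ := ht.scale_bounds
  have hx0 := ht.nonneg (P.reg (src e))
  have hx1 := ht.le (P.reg (src e))
  have hle := ht.line_ge
  have hmin : ∀ m, l e ≤ l m := fun m => by
    by_cases hm : m = e
    · rw [hm]
    · exact (ht.line_min m hm).le
  interval_cases r <;> rcases i with q | q | m | j | _ <;>
    simp only [stage, hub, assemble, Idle, active, ne_eq, Coord.A.injEq, Coord.B.injEq,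
      Coord.M.injEq, Coord.X.injEq, reduceCtorEq, not_false_eq_true, exists_eq',
      or_false, false_or, not_true_eq_false] at hi h0 ⊢
  all_goals first
    | exact hi h0
    | (split_ifs at h0 <;> first | assumption | exact absurd h0 hs.ne' | exact hi ‹_›)
    | (have := ht.hub_pos m; have := ht.mid_pos m; have := hmin m; linarith)
    | (have := ht.line_min m hi; linarith)
    | (have := ht.nonneg j; have := ht.nonneg' j; have := ht.gain_bounds j
       split_ifs at h0 <;> first | assumption | linarith)
    | (have := ht.nonneg j; have := ht.nonneg' j; linarith)
    | linarith
    | (have : 0 < (P.scale e : ℝ) * s * (1 + if q = P.dst e then 0 else 1) := by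
         split_ifs <;> linarith
       linarith)

/-- The sign conditions need checking only on the few idle coordinates. The delicate case is `p = M
e`, where `row` amounts to `tiltA_le` and `tiltB_le`, and `col` uses `refill_nonneg`. -/
theorem phase (ht : P.Transition e s x x' h h' l) {r : ℕ} (hr : r < 5) :
    Phase P.matrix (P.active e r) (P.stage e s x x' h h' l r) (P.stage e s x x' h h' l (r + 1))
      (P.duration e s x l r) where
  time_nonneg := by
    have hs := ht.scale_pos
    have hx0 := ht.nonneg (P.reg (src e))
    have hx1 := ht.le (P.reg (src e))
    have hle := ht.line_ge
    have hs1 := ht.scale_bounds.1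
    interval_cases r <;> simp only [duration] <;> linarith
  nonneg i := (ht.stage_bounds r i).1
  nonneg' i := (ht.stage_bounds (r + 1) i).1
  active := by interval_cases r <;> simp [stage, hub, assemble, active]
  move := ht.stage_move hr
  row i hi h0 := by
    have := ht.idle_of_stage_eq_zero hr hi h0
    have hA : (tiltA (src e) e : ℝ) ≤ -1 := by exact_mod_cast ht.tiltA_le
    have hB : (tiltB (src e) e : ℝ) ≤ -1 := by exact_mod_cast ht.tiltB_le
    interval_cases r <;> simp only [Idle] at this
    · subst this; simp [matrix, matrixQ, drift, active]
    · subst this; simp [matrix, matrixQ, drift, active]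
    · rcases this with rfl | rfl <;> simp [matrix, matrixQ, drift, active]
    · rcases this with rfl | rfl | rfl <;> simp [matrix, matrixQ, drift, active] <;> linarith
    · obtain ⟨m, rfl⟩ := this; simp [matrix, matrixQ, drift, active]
  col i hi h0 := by
    have := ht.idle_of_stage_eq_zero hr hi h0
    have hs := P.scale_pos e
    have hR := ht.refill_nonneg
    interval_cases r <;> simp only [Idle] at this
    · subst this; simp [matrix, matrixQ, drift, active]
    · subst this; simp [matrix, matrixQ, drift, active]
    · rcases this with rfl | rfl <;> simp [matrix, matrixQ, drift, active]
    · rcases this with rfl | rfl | rfl <;> simp [matrix, matrixQ, drift, active]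
      · split_ifs <;> norm_num <;> linarith
      · linarith
      · linarith
    · obtain ⟨m, rfl⟩ := this; simp [matrix, matrixQ, drift, active]
  block i j hi hj h0 h0' := by
    have h1 := ht.idle_of_stage_eq_zero hr hi h0
    have h2 := ht.idle_of_stage_eq_zero hr hj h0'
    interval_cases r <;> simp only [Idle] at h1 h2
    · subst h1 h2; simp [matrix, matrixQ, drift]
    · subst h1 h2; simp [matrix, matrixQ, drift]
    · rcases h1 with rfl | rfl <;> rcases h2 with rfl | rfl <;> simp [matrix, matrixQ, drift]
    · rcases h1 with rfl | rfl | rfl <;> rcases h2 with rfl | rfl | rfl <;>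
        simp [matrix, matrixQ, drift]
    · obtain ⟨m, rfl⟩ := h1
      obtain ⟨m', rfl⟩ := h2
      simp only [matrix, matrixQ, drift, Matrix.map_apply]
      split_ifs <;> norm_num

/-- The five phases at a node. -/
theorem run (ht : P.Transition e s x x' h h' l) {B : ℝ} (hB : 1000 * s ≤ B) :
    ∃ T, s ≤ T ∧ Run P.matrix B 5 (hub (src e) s x h) T (hub (P.dst e) (P.scale e * s) x' h') := by
  have hb : ∀ r i, P.stage e s x x' h h' l r i ≤ B := fun r i => (ht.stage_bounds r i).2.trans hB
  have h5 : Run P.matrix B 0 (P.stage e s x x' h h' l 5) 0 (P.stage e s x x' h h' l 5) :=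
    .refl _ (hb 5)
  have h4 := Run.step _ (hb 4) (ht.phase (r := 4) (by norm_num)) h5
  have h3 := Run.step _ (hb 3) (ht.phase (r := 3) (by norm_num)) h4
  have h2 := Run.step _ (hb 2) (ht.phase (r := 2) (by norm_num)) h3
  have h1 := Run.step _ (hb 1) (ht.phase (r := 1) (by norm_num)) h2
  have h0 := Run.step _ (hb 0) (ht.phase (r := 0) (by norm_num)) h1
  exact ⟨_, le_add_of_nonneg_right h1.time_nonneg, h0⟩

end Transition

end Program

/-! ### Reading a stack and moving it back -/

namespace Program

variable {Λ : Type} [DecidableEq Λ] (P : Program Λ)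

/-- The values that are compared at a node whose inspected register contains `ξ`. -/
def lines (q : Node Λ) (s ξ : ℝ) (m : Edge Λ) : ℝ :=
  match q with
  | .fst l => -(if src m = .fst l then s else 0) - 96 * s + height l m * s - slope l m * ξ
  | .snd l d => -(if src m = .snd l d then s else 0)

/-- The offsets of the coordinates `M` at the arrival in a node. -/
def offset (q : Node Λ) (ξ : ℝ) (s : ℝ) (m : Edge Λ) : ℝ :=
  match q with
  | .fst _ => 0
  | .snd l d => (height l m - (digit d : ℝ) ^ 2) * s + (20 * digit d - slope l m) * ξ

/-- The registers at the node `fst l`. -/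
def regs (x : K' → ℝ) : Option K' → ℝ
  | none => 0
  | some k => x k

/-- The registers at the node `snd l d`. -/
def regs' (k : K') (x : K' → ℝ) : Option K' → ℝ
  | none => x k
  | some j => if j = k then 0 else x j

theorem height_slope_cases (l : Λ) (m : Edge Λ) :
    (∃ d, m = .fst l d ∧ height l m = (digit d : ℚ) ^ 2 ∧ slope l m = 20 * digit d ∧
      src m = .fst l) ∨
    (height l m = 96 ∧ slope l m = 0 ∧ src m ≠ .fst l) := by
  rcases m with ⟨l', d⟩ | ⟨l', d⟩
  · by_cases h : l' = l
    · subst h; exact Or.inl ⟨d, by simp [height, slope, src]⟩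
    · exact Or.inr (by simp [height, slope, src, h])
  · exact Or.inr (by simp [height, slope, src])

theorem height_self (l : Λ) (d : Option Γ') : height l (.fst l d) = (digit d : ℚ) ^ 2 := if_pos rfl

theorem height_snd (l l' : Λ) (d : Option Γ') : height l (.snd l' d) = 96 := rfl

theorem slope_self (l : Λ) (d : Option Γ') : slope l (.fst l d) = 20 * (digit d : ℚ) := if_pos rfl

theorem slope_snd (l l' : Λ) (d : Option Γ') : slope l (.snd l' d) = 0 := rfl

theorem digit_cast_le (d : Option Γ') : (digit d : ℝ) ≤ 4 := by exact_mod_cast digit_le d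

theorem digit_cast_le' (d : Option Γ') : (digit d : ℚ) ≤ 4 := by exact_mod_cast digit_le d

/-- Distinct digits differ by at least `1 > 2 * f`, so both factors have the same sign. The product
is `(d' - (d + f))² - f²`: the integer nearest to `d + f` is `d`. -/
theorem sq_digit_sub (d d' : Option Γ') (f : ℝ) (hf0 : 0 ≤ f) (hf : f ≤ 4 / 9) (hd : d' ≠ d) :
    0 < ((digit d' : ℝ) - digit d) * (digit d' - digit d - 2 * f) := by
  have hne : digit d' ≠ digit d := fun h => hd (digit_injective h)
  rcases lt_or_gt_of_ne hne with h | h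
  · have : (digit d' : ℝ) + 1 ≤ digit d := by exact_mod_cast h
    exact mul_pos_of_neg_of_neg (by linarith) (by linarith)
  · have : (digit d : ℝ) + 1 ≤ digit d' := by exact_mod_cast h
    exact mul_pos (by linarith) (by linarith)

/-- The hypothesis `hd` says that `d` is the leading digit of the inspected register and `f` the
fraction behind it; it serves to show that the edge `fst l d` wins the comparison. -/
theorem transition_fst {l : Λ} {d : Option Γ'} {s f : ℝ} {x : K' → ℝ} (hs : 0 < s)
    (hx : ∀ k, 0 ≤ x k) (hx' : ∀ k, x k ≤ s) (hd : 10 * x (P.stk l) = (digit d + f) * s)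
    (hf0 : 0 ≤ f) (hf : f ≤ 4 / 9) :
    P.Transition (.fst l d) s (regs x) (regs' (P.stk l) x) 0 (offset (.snd l d) (x (P.stk l)) s)
      (lines (.fst l) s (x (P.stk l))) := by
  set ξ := x (P.stk l) with hξ
  have hξ0 : 0 ≤ ξ := hx _
  have hd0 : (0 : ℝ) ≤ digit d := Nat.cast_nonneg _
  have hd4 := digit_cast_le d
  have hd4' := digit_cast_le' d
  have hd0' : (0 : ℚ) ≤ digit d := Nat.cast_nonneg _
  have hξ1 : 2 * ξ ≤ s := by nlinarith
  -- The gap between the lines of `d'` and `d`, after eliminating `ξ` by `10 ξ = (d + f) s`.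
  have hgap : ∀ d', ((digit d' : ℝ) ^ 2 - digit d ^ 2) * s + (20 * digit d - 20 * digit d') * ξ =
      ((digit d' : ℝ) - digit d) * (digit d' - digit d - 2 * f) * s := by
    intro d'
    linear_combination (2 * digit d - 2 * digit d' : ℝ) * hd
  have hdξ : digit d * ξ ≤ 2 * s := by nlinarith
  have hdξ0 : 0 ≤ digit d * ξ := by positivity
  have hsq : (digit d : ℝ) ^ 2 ≤ 16 := by nlinarith
  have hsqs : (digit d : ℝ) ^ 2 * s ≤ 16 * s := by nlinarith
  have hsqs0 : 0 ≤ (digit d : ℝ) ^ 2 * s := by positivity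
  refine
    { scale_pos := hs
      nonneg := fun j => ?_
      nonneg' := fun j => ?_
      le := fun j => ?_
      le' := fun j => ?_
      line := fun m => ?_
      hub_pos := fun m => ?_
      hub_le := fun m => ?_
      mid_pos := fun m => ?_
      mid_le := fun m => ?_
      line_min := fun m hm => ?_
      line_ge := ?_
      line_le := fun m => ?_
      tiltA_le := ?_
      tiltB_le := ?_
      fill := fun j => ?_
      refill_nonneg := ?_
      offset := fun m => ?_
      offset_nonneg := fun m => ?_ }
  · cases j <;> simp [regs, hx]
  · cases j <;> simp only [regs'] <;> try split_ifs
    all_goals first | exact hx _ | exact le_refl _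
  · cases j <;> simp [regs, hx', hs.le]
  · cases j <;> simp only [regs'] <;> try split_ifs
    all_goals first | exact hx' _ | exact hs.le
  · simp only [lines, src_fst, tiltA, tiltB, reg, regs, Pi.zero_apply]
    push_cast
    rw [← hξ]
    split_ifs <;> ring
  · simp; positivity
  · simp only [Pi.zero_apply]; linarith
  · simp only [Pi.zero_apply, src_fst, tiltA]
    rcases height_slope_cases l m with ⟨d', -, h1, h2, h3⟩ | ⟨h1, h2, h3⟩
    · have : (0 : ℝ) ≤ digit d' := Nat.cast_nonneg _
      rw [h1, h2, if_pos h3]; push_cast; nlinarith [sq_nonneg (digit d' : ℝ)]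
    · rw [h1, h2, if_neg h3]; push_cast; nlinarith
  · simp only [Pi.zero_apply, src_fst, tiltA]
    rcases height_slope_cases l m with ⟨d', -, h1, h2, h3⟩ | ⟨h1, h2, h3⟩
    · have h4 : (0 : ℝ) ≤ digit d' := Nat.cast_nonneg _
      have h5 := digit_cast_le d'
      have h6 : (digit d' : ℝ) ^ 2 ≤ 16 := by nlinarith
      rw [h1, h2, if_pos h3]; push_cast; nlinarith
    · rw [h1, h2, if_neg h3]; push_cast; nlinarith
  · simp only [lines, src_fst, height_self, slope_self, if_true]
    rcases height_slope_cases l m with ⟨d', hm', h1, h2, h3⟩ | ⟨h1, h2, h3⟩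
    · have hdd : d' ≠ d := fun h => hm (by rw [hm', h])
      have h4 := mul_pos (sq_digit_sub d d' f hf0 hf hdd) hs
      have h5 := hgap d'
      rw [h1, h2, if_pos h3]; push_cast; linarith
    · rw [h1, h2, if_neg h3]; push_cast; linarith
  · simp only [lines, src_fst, height_self, slope_self, if_true]
    push_cast; linarith
  · simp only [lines]
    rcases height_slope_cases l m with ⟨d', -, h1, h2, h3⟩ | ⟨h1, h2, h3⟩
    · have h4 : (0 : ℝ) ≤ digit d' := Nat.cast_nonneg _
      have h5 := digit_cast_le d'
      have h6 : (digit d' : ℝ) ^ 2 ≤ 16 := by nlinarith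
      have h7 : 0 ≤ digit d' * ξ := by positivity
      rw [h1, h2, if_pos h3]; push_cast; nlinarith
    · rw [h1, h2, if_neg h3]; push_cast; linarith
  · simp only [src_fst, tiltA, if_true, height_self, slope_self, if_true]
    nlinarith
  · simp only [src_fst, tiltB, slope_self]
    linarith
  · simp only [src_fst, reg, scale, gain, refill, regs, regs']
    rcases j with _ | j
    · simp only [← hξ, reduceCtorEq, if_false, if_true]; push_cast; ring
    · by_cases hj : j = P.stk l
      · subst hj; norm_num; ring
      · simp [hj]
  · simp [src_fst, reg, refill]
  · simp only [lines, src_fst, height_self, slope_self, if_true, Program.offset]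
    by_cases h : src m = .fst l
    · simp only [h, if_true]; push_cast; ring
    · rcases height_slope_cases l m with ⟨d', -, -, -, h3⟩ | ⟨h1, h2, -⟩
      · exact absurd h3 h
      · simp only [h1, h2, h, if_false]; push_cast; ring
  · simp only [Program.offset]
    rcases height_slope_cases l m with ⟨d', hm', h1, h2, h3⟩ | ⟨h1, h2, h3⟩
    · rw [h1, h2]; push_cast; rw [hgap d']
      by_cases hdd : d' = d
      · simp [hdd]
      · exact (mul_pos (sq_digit_sub d d' f hf0 hf hdd) hs).le
    · rw [h1, h2]; push_cast; linarith

/-- The temporary register again contains `ξ`, so the tilts accumulated while it is drained cancel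
the offsets exactly. Only the edge `snd l d` starts at this node; its line lies `s` below all
others, and the offsets end at `0`. -/
theorem transition_snd {l : Λ} {d : Option Γ'} {s : ℝ} {x x' : K' → ℝ} (hs : 0 < s)
    (hx : ∀ k, 0 ≤ x k) (hx' : ∀ k, x k ≤ s) (hξ1 : 2 * x (P.stk l) ≤ s)
    (hn : 0 ≤ x' (P.stk l)) (hl : x' (P.stk l) ≤ s)
    (hk : x' (P.stk l) = (P.act l d).factor * x (P.stk l) + (P.act l d).shift d * s)
    (hj : ∀ j, j ≠ P.stk l → x' j = x j) :
    P.Transition (.snd l d) s (regs' (P.stk l) x) (regs x') (offset (.snd l d) (x (P.stk l)) s) 0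
      (lines (.snd l d) s (x (P.stk l))) := by
  set ξ := x (P.stk l) with hξ
  have hξ0 : 0 ≤ ξ := hx _
  have hd0 : (0 : ℝ) ≤ digit d := Nat.cast_nonneg _
  have hd4 := digit_cast_le d
  have hd4' := digit_cast_le' d
  have hd0' : (0 : ℚ) ≤ digit d := Nat.cast_nonneg _
  have hdξ : digit d * ξ ≤ 2 * s := by nlinarith
  have hdξ0 : 0 ≤ digit d * ξ := by positivity
  have hds : digit d * s ≤ 4 * s := by nlinarith
  have hds0 : 0 ≤ digit d * s := by positivity
  have hsq : (digit d : ℝ) ^ 2 ≤ 16 := by nlinarith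
  have hsqs : (digit d : ℝ) ^ 2 * s ≤ 16 * s := by nlinarith
  have hsqs0 : 0 ≤ (digit d : ℝ) ^ 2 * s := by positivity
  have hx'0 : ∀ j, 0 ≤ x' j := fun j => by
    by_cases h : j = P.stk l
    · rw [h]; exact hn
    · rw [hj j h]; exact hx j
  have hx'1 : ∀ j, x' j ≤ s := fun j => by
    by_cases h : j = P.stk l
    · rw [h]; exact hl
    · rw [hj j h]; exact hx' j
  have hbound : ∀ m : Edge Λ, 0 ≤ (height l m : ℝ) * s ∧ (height l m : ℝ) * s ≤ 96 * s ∧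
      0 ≤ (slope l m : ℝ) * ξ ∧ (slope l m : ℝ) * ξ ≤ 40 * s ∧ 0 ≤ (slope l m : ℝ) * s ∧
      (slope l m : ℝ) * s ≤ 80 * s := by
    intro m
    rcases height_slope_cases l m with ⟨d', -, h1, h2, -⟩ | ⟨h1, h2, -⟩
    · have h4 : (0 : ℝ) ≤ digit d' := Nat.cast_nonneg _
      have h5 := digit_cast_le d'
      have h6 : (digit d' : ℝ) ^ 2 ≤ 16 := by nlinarith
      rw [h1, h2]; push_cast
      refine ⟨by positivity, by nlinarith, by positivity, by nlinarith, by positivity,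
        by nlinarith⟩
    · rw [h1, h2]; push_cast
      refine ⟨?_, ?_, ?_, ?_, ?_, ?_⟩ <;> linarith
  refine
    { scale_pos := hs
      nonneg := fun j => ?_
      nonneg' := fun j => ?_
      le := fun j => ?_
      le' := fun j => ?_
      line := fun m => ?_
      hub_pos := fun m => ?_
      hub_le := fun m => ?_
      mid_pos := fun m => ?_
      mid_le := fun m => ?_
      line_min := fun m hm => ?_
      line_ge := ?_
      line_le := fun m => ?_
      tiltA_le := ?_
      tiltB_le := ?_
      fill := fun j => ?_
      refill_nonneg := ?_
      offset := fun m => ?_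
      offset_nonneg := fun m => le_refl _ }
  · cases j <;> simp only [regs'] <;> try split_ifs
    all_goals first | exact hx _ | exact le_refl _
  · cases j <;> simp [regs, hx'0]
  · cases j <;> simp only [regs'] <;> try split_ifs
    all_goals first | exact hx' _ | exact hs.le
  · cases j <;> simp [regs, hx'1, hs.le]
  · simp only [lines, src_snd, tiltA, tiltB, reg, regs', Program.offset]
    push_cast
    rw [← hξ]
    split_ifs <;> ring
  · simp only [Program.offset]; have := hbound m; linarith
  · simp only [Program.offset]; have := hbound m; linarith
  · simp only [Program.offset, src_snd, tiltA]; have := hbound m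
    split_ifs <;> push_cast <;> linarith
  · simp only [Program.offset, src_snd, tiltA]; have := hbound m
    split_ifs <;> push_cast <;> linarith
  · have h1 : src m ≠ .snd l d := by
      rcases m with ⟨l', d'⟩ | ⟨l', d'⟩
      · rw [src_fst]; simp
      · rw [src_snd]
        intro h
        injection h with h1 h2
        exact hm (by rw [h1, h2])
    simp only [lines, src_snd, if_true, if_neg h1]
    linarith
  · simp only [lines, src_snd, if_true]; linarith
  · simp only [lines]; split_ifs <;> linarith
  · simp only [src_snd, tiltA, if_true, height_snd, slope_snd, if_true]
    nlinarith
  · simp only [src_snd, tiltB, slope_snd]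
    linarith
  · simp only [src_snd, reg, scale, gain, refill, regs, regs']
    rcases j with _ | j
    · norm_num; ring
    · by_cases hjk : j = P.stk l
      · subst hjk; simp only [reduceCtorEq, if_false, if_true, hk, ← hξ]; push_cast; ring
      · simp only [reduceCtorEq, if_false, Option.some.injEq, hjk, hj j hjk]; push_cast; ring
  · simp only [src_snd, reg, refill, if_true]
    have := (P.act l d).scale_pos
    linarith
  · by_cases h : src m = .snd l d
    · simp only [lines, src_snd, if_true, h, Pi.zero_apply]; ring
    · simp only [lines, src_snd, if_true, if_false, h, Pi.zero_apply]; ring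

end Program

/-! ### Simulation of a stack program -/

/-- The real number with the decimal digits given by the symbols of a stack. -/
noncomputable def enc : List Γ' → ℝ
  | [] => 0
  | a :: L => (digit (some a) + enc L) / 10

theorem enc_nonneg (L : List Γ') : 0 ≤ enc L := by
  induction L with
  | nil => exact le_refl _
  | cons a L ih => simp only [enc]; positivity

/-- The extreme value is `0.444…`. Being below `1/2`, it lets rounding recover the top digit. -/
theorem enc_le (L : List Γ') : enc L ≤ 4 / 9 := by
  induction L with
  | nil => norm_num [enc]
  | cons a L ih =>
    have : (digit (some a) : ℝ) ≤ 4 := by exact_mod_cast digit_le _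
    simp only [enc]; linarith

theorem ten_mul_enc (L : List Γ') : 10 * enc L = digit L.head? + enc L.tail := by
  cases L
  · simp [enc, digit]
  · simp only [enc, List.head?_cons, List.tail_cons]; ring

/-- The effect of an action on the inspected stack. -/
def Act.apply : Act → List Γ' → List Γ'
  | .push a, L => a :: L
  | .pop, L => L.tail
  | .keep, L => L
  | .halve, L => L

theorem Act.scale_mul_enc_apply (a : Act) (L : List Γ') :
    (a.scale : ℝ) * enc (a.apply L) = a.factor * enc L + a.shift L.head? := by
  have := ten_mul_enc L
  cases a <;> simp only [scale, apply, factor, shift, enc] <;> push_cast <;> linarith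

/-- A label together with the contents of the stacks. -/
abbrev Config (Λ : Type) : Type := Λ × (K' → List Γ')

namespace Program

variable {Λ : Type} (P : Program Λ)

/-- The top symbol of the inspected stack. -/
def top (c : Config Λ) : Option Γ' := (c.2 (P.stk c.1)).head?

/-- The action that is applied to the inspected stack. -/
def actAt (c : Config Λ) : Act := P.act c.1 (P.top c)

def step (c : Config Λ) : Config Λ :=
  (P.nxt c.1 (P.top c), Function.update c.2 (P.stk c.1) ((P.actAt c).apply (c.2 (P.stk c.1))))

/-- The state of the fluid model that represents a configuration at the scale `s`. -/
noncomputable def state [DecidableEq Λ] (s : ℝ) (c : Config Λ) : Coord Λ → ℝ :=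
  hub (.fst c.1) s (regs fun k => s * enc (c.2 k)) 0

theorem state_le [DecidableEq Λ] {s : ℝ} (hs : 0 < s) (c : Config Λ) (i : Coord Λ) :
    state s c i ≤ 1000 * s := by
  rcases i with q | q | m | (_ | k) | _ <;> simp only [state, hub, assemble, regs, Pi.zero_apply]
  · split_ifs <;> linarith
  · linarith
  · linarith
  · linarith
  · nlinarith [enc_le (c.2 k)]
  · linarith

/-- Halving rescales only the inspected register. The others keep their contents, which represent
the same stacks at the new scale when they are empty; hence `hc`. -/
theorem run_step [DecidableEq Λ] {B s : ℝ} (hs : 0 < s) (hB : 1000 * s ≤ B) (c : Config Λ)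
    (hc : P.actAt c = .halve → ∀ k, k ≠ P.stk c.1 → c.2 k = []) :
    ∃ T, s ≤ T ∧
      Run P.matrix B 10 (state s c) T (state ((P.actAt c).scale * s) (P.step c)) := by
  obtain ⟨l, S⟩ := c
  have h0 : ∀ k, 0 ≤ s * enc (S k) := fun k => mul_nonneg hs.le (enc_nonneg _)
  have h1 : ∀ k, 2 * (s * enc (S k)) ≤ s := fun k => by nlinarith [enc_le (S k)]
  set d := P.top (l, S) with hd
  set a := P.actAt (l, S) with ha
  have hsc : (0 : ℝ) < a.scale := by exact_mod_cast a.scale_pos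
  have hsc1 : (a.scale : ℝ) ≤ 1 := by exact_mod_cast a.scale_le_one
  obtain ⟨T₁, hT₁, r₁⟩ := (P.transition_fst (l := l) (d := d) (s := s)
    (f := enc (S (P.stk l)).tail) (x := fun k => s * enc (S k)) hs h0
    (fun k => by linarith [h0 k, h1 k])
    (by
      have h2 := ten_mul_enc (S (P.stk l))
      have h3 : (S (P.stk l)).head? = d := rfl
      rw [h3] at h2
      linear_combination s * h2) (enc_nonneg _) (enc_le _)).run hB
  obtain ⟨T₂, hT₂, r₂⟩ := (P.transition_snd (l := l) (d := d) (s := s)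
    (x := fun k => s * enc (S k))
    (x' := fun k => a.scale * s * enc ((P.step (l, S)).2 k)) hs h0
    (fun k => by linarith [h0 k, h1 k]) (h1 _)
    (mul_nonneg (mul_nonneg hsc.le hs.le) (enc_nonneg _))
    (by
      have h2 := enc_nonneg ((P.step (l, S)).2 (P.stk l))
      have h3 := enc_le ((P.step (l, S)).2 (P.stk l))
      have h4 : (a.scale : ℝ) * s ≤ s := by nlinarith
      nlinarith)
    (by
      have h2 := a.scale_mul_enc_apply (S (P.stk l))
      have h3 : (P.step (l, S)).2 (P.stk l) = a.apply (S (P.stk l)) := Function.update_self ..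
      have h4 : P.act l d = a := rfl
      have h5 : (S (P.stk l)).head? = d := rfl
      rw [h3, h4]
      rw [h5] at h2
      linear_combination s * h2)
    (fun j hj => by
      have h3 : (P.step (l, S)).2 j = S j := Function.update_of_ne hj ..
      rw [h3]
      by_cases h : a = .halve
      · have h4 : S j = [] := hc h j hj
        rw [h4]; simp [enc]
      · have : a.scale = 1 := by
          revert h; cases a <;> simp [Act.scale]
        rw [this]; simp)).run hB
  refine ⟨T₁ + T₂, by linarith, ?_⟩
  have e1 : (P.scale (.fst l d) : ℝ) * s = s := by simp [scale]
  rw [e1] at r₁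
  exact r₁.trans r₂

/-- `n` steps lead from one configuration to another one, and the scale is never halved. -/
inductive Path : ℕ → Config Λ → Config Λ → Prop
  | refl (c : Config Λ) : Path 0 c c
  | head {n : ℕ} {c c' : Config Λ} (hc : P.actAt c ≠ .halve) (h : Path n (P.step c) c') :
      Path (n + 1) c c'

variable {P}

theorem Path.trans {m n : ℕ} {c c' c'' : Config Λ} (h : P.Path m c c') (h' : P.Path n c' c'') :
    P.Path (m + n) c c'' := by
  induction h with
  | refl c => rwa [zero_add]
  | head hc _ ih => rw [Nat.add_right_comm]; exact .head hc (ih h')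

theorem Path.run [DecidableEq Λ] {B s : ℝ} (hs : 0 < s) (hB : 1000 * s ≤ B) {n : ℕ}
    {c c' : Config Λ} (h : P.Path n c c') :
    ∃ T, n * s ≤ T ∧ Run P.matrix B (10 * n) (state s c) T (state s c') := by
  induction h with
  | refl c =>
    exact ⟨0, by simp, .refl _ fun i => (state_le hs c i).trans hB⟩
  | @head n c c' hc h ih =>
    obtain ⟨T, hT, r⟩ := ih
    obtain ⟨T', hT', r'⟩ := P.run_step hs hB c fun h => absurd h hc
    have : ((P.actAt c).scale : ℝ) = 1 := by
      revert hc; cases P.actAt c <;> simp [Act.scale]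
    rw [this, one_mul] at r'
    refine ⟨T' + T, by push_cast; linarith, ?_⟩
    have := r'.trans r
    rwa [show 10 + 10 * n = 10 * (n + 1) by ring] at this

/-- The restriction of a program to a set of labels that it does not leave. -/
def restrict (P : Program Λ) (F : Finset Λ) (hF : ∀ l ∈ F, ∀ d, P.nxt l d ∈ F) : Program F where
  stk l := P.stk l
  act l := P.act l
  nxt l d := ⟨P.nxt l d, hF l l.2 d⟩

theorem Path.restrict {F : Finset Λ} {hF : ∀ l ∈ F, ∀ d, P.nxt l d ∈ F} {n : ℕ}
    {c c' : Config Λ} (h : P.Path n c c') (hc : c.1 ∈ F) :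
    ∃ hc' : c'.1 ∈ F, (P.restrict F hF).Path n (⟨c.1, hc⟩, c.2) (⟨c'.1, hc'⟩, c'.2) := by
  induction h with
  | refl c => exact ⟨hc, .refl _⟩
  | head hn _ ih =>
    obtain ⟨hc', h⟩ := ih (hF _ hc _)
    exact ⟨hc', .head hn h⟩

end Program

/-! ### Turing machines with stacks -/

/-- The labels at which the stacks are cleared, and those of the loop that doubles the height of the
stack `main` and halves the scale. -/
inductive Loop
  | clear (k : K')
  | start
  | take
  | put₁
  | put₂
  | shrink
  | back
  | put
  deriving Fintype

open Turing (TM2.Stmt TM2.Cfg)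
open Turing.TM2 (stepAux)
open Turing.TM2.Stmt

section

variable {L σ : Type}

/-- The labels of the program of a machine with stacks: a statement under execution together with
the value of the variables, or a label of the final loop. -/
abbrev Label (L σ : Type) : Type := (Turing.TM2.Stmt (fun _ : K' => Γ') L σ × σ) ⊕ Loop

/-- The program that simulates a machine with stacks and, after it has halted, clears the stacks and
enters a loop. -/
def machine (M : L → Turing.TM2.Stmt (fun _ : K' => Γ') L σ) : Program (Label L σ) where
  stk
    | .inl (push k _ _, _) => k
    | .inl (peek k _ _, _) => k
    | .inl (pop k _ _, _) => k
    | .inl _ => .main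
    | .inr (.clear k) => k
    | .inr .put₁ => .rev
    | .inr .put₂ => .rev
    | .inr .shrink => .rev
    | .inr .back => .rev
    | .inr _ => .main
  act
    | .inl (push _ f _, v), _ => .push (f v)
    | .inl (pop _ _ _, _), _ => .pop
    | .inl _, _ => .keep
    | .inr (.clear _), _ => .pop
    | .inr .take, _ => .pop
    | .inr .back, _ => .pop
    | .inr .shrink, _ => .halve
    | .inr _, _ => .push .cons
  nxt
    | .inl (push _ _ q, v), _ => .inl (q, v)
    | .inl (peek _ f q, v), d => .inl (q, f v d)
    | .inl (pop _ f q, v), d => .inl (q, f v d)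
    | .inl (load a q, v), _ => .inl (q, a v)
    | .inl (branch f q₁ q₂, v), _ => .inl (cond (f v) q₁ q₂, v)
    | .inl (goto f, v), _ => .inl (M (f v), v)
    | .inl (halt, _), _ => .inr (.clear .main)
    | .inr (.clear k), some _ => .inr (.clear k)
    | .inr (.clear .main), none => .inr (.clear .rev)
    | .inr (.clear .rev), none => .inr (.clear .aux)
    | .inr (.clear .aux), none => .inr (.clear .stack)
    | .inr (.clear .stack), none => .inr .start
    | .inr .start, _ => .inr .take
    | .inr .take, some _ => .inr .put₁
    | .inr .take, none => .inr .shrink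
    | .inr .put₁, _ => .inr .put₂
    | .inr .put₂, _ => .inr .take
    | .inr .shrink, _ => .inr .back
    | .inr .back, some _ => .inr .put
    | .inr .back, none => .inr .take
    | .inr .put, _ => .inr .back

variable (M : L → Turing.TM2.Stmt (fun _ : K' => Γ') L σ)

/-- The configuration of the program that corresponds to a configuration of the machine. -/
def machineConfig : TM2.Cfg (fun _ : K' => Γ') L σ → Config (Label L σ)
  | ⟨some l, v, S⟩ => (.inl (M l, v), S)
  | ⟨none, _, S⟩ => (.inr (.clear .main), S)

theorem machine_actAt_ne_halve {c : Config (Label L σ)} (hc : c.1 ≠ .inr .shrink) :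
    (machine M).actAt c ≠ .halve := by
  obtain ⟨(⟨q, v⟩ | l), S⟩ := c
  · cases q <;> simp [Program.actAt, machine]
  · cases l <;> simp_all [Program.actAt, machine]

/-- Each constructor of a statement costs one program step; those that touch no stack inspect `main`
and keep it. -/
theorem machine_path_stepAux (q : Turing.TM2.Stmt (fun _ : K' => Γ') L σ) (v : σ)
    (S : K' → List Γ') :
    ∃ n, (machine M).Path n (.inl (q, v), S) (machineConfig M (stepAux q v S)) := by
  have key : ∀ (q q' : Turing.TM2.Stmt (fun _ : K' => Γ') L σ) (v v' : σ) (S S' : K' → List Γ'),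
      (∃ n, (machine M).Path n (.inl (q', v'), S') (machineConfig M (stepAux q' v' S'))) →
      (machine M).step (.inl (q, v), S) = (.inl (q', v'), S') →
      stepAux q v S = stepAux q' v' S' →
      ∃ n, (machine M).Path n (.inl (q, v), S) (machineConfig M (stepAux q v S)) := by
    rintro q q' v v' S S' ⟨n, h⟩ h1 h2
    exact ⟨n + 1, .head (machine_actAt_ne_halve M (by simp)) (by rw [h1, h2]; exact h)⟩
  induction q generalizing v S with
  | push k f q ih => exact key _ q _ v _ _ (ih v _) rfl rfl
  | peek k f q ih =>
    refine key _ q _ _ _ S (ih (f v (S k).head?) S) ?_ rfl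
    exact Prod.ext rfl (Function.update_eq_self k S)
  | pop k f q ih => exact key _ q _ _ _ _ (ih (f v (S k).head?) _) rfl rfl
  | load a q ih =>
    refine key _ q _ _ _ S (ih (a v) S) ?_ rfl
    exact Prod.ext rfl (Function.update_eq_self K'.main S)
  | branch f q₁ q₂ ih₁ ih₂ =>
    refine key _ (cond (f v) q₁ q₂) _ v _ S ?_ ?_ ?_
    · cases f v
      · exact ih₂ v S
      · exact ih₁ v S
    · exact Prod.ext rfl (Function.update_eq_self K'.main S)
    · simp only [stepAux]; cases f v <;> rfl
  | goto f =>
    refine ⟨1, .head (machine_actAt_ne_halve M (by simp)) ?_⟩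
    have : (machine M).step (.inl (goto f, v), S) = machineConfig M (stepAux (goto f) v S) :=
      Prod.ext rfl (Function.update_eq_self K'.main S)
    rw [this]; exact .refl _
  | halt =>
    refine ⟨1, .head (machine_actAt_ne_halve M (by simp)) ?_⟩
    have : (machine M).step (.inl (halt, v), S) = machineConfig M (stepAux halt v S) :=
      Prod.ext rfl (Function.update_eq_self K'.main S)
    rw [this]; exact .refl _

theorem machine_path_of_reaches {a b : TM2.Cfg (fun _ : K' => Γ') L σ}
    (h : StateTransition.Reaches (Turing.TM2.step M) a b) :
    ∃ n, (machine M).Path n (machineConfig M a) (machineConfig M b) := by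
  induction h using Relation.ReflTransGen.head_induction_on with
  | refl => exact ⟨0, .refl _⟩
  | @head a c hac _ ih =>
    obtain ⟨n, h⟩ := ih
    obtain ⟨_ | l, v, S⟩ := a
    · simp at hac
    · simp only [Turing.TM2.step, Option.mem_def, Option.some.injEq] at hac
      subst hac
      obtain ⟨m, h'⟩ := machine_path_stepAux M (M l) v S
      exact ⟨_, h'.trans h⟩

/-- As long as the machine does not halt, the program remains at the labels of the machine. -/
theorem machine_iterate {a : TM2.Cfg (fun _ : K' => Γ') L σ} (ha : a.l ≠ none)
    (h : ¬ (StateTransition.eval (Turing.TM2.step M) a).Dom) (n : ℕ) :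
    ∃ q v S, (machine M).step^[n] (machineConfig M a) = (.inl (q, v), S) ∧
      StateTransition.Reaches (Turing.TM2.step M) a (stepAux q v S) := by
  induction n with
  | zero =>
    obtain ⟨_ | l, v, S⟩ := a
    · simp at ha
    · exact ⟨M l, v, S, rfl, .single rfl⟩
  | succ n ih =>
    obtain ⟨q, v, S, h1, h2⟩ := ih
    rw [Function.iterate_succ_apply', h1]
    cases q with
    | push k f q => exact ⟨_, _, _, rfl, h2⟩
    | peek k f q =>
      exact ⟨q, f v (S k).head?, S, Prod.ext rfl (Function.update_eq_self k S), h2⟩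
    | pop k f q => exact ⟨q, f v (S k).head?, _, rfl, h2⟩
    | load a q => exact ⟨q, a v, S, Prod.ext rfl (Function.update_eq_self K'.main S), h2⟩
    | branch f q₁ q₂ =>
      refine ⟨cond (f v) q₁ q₂, v, S, Prod.ext rfl (Function.update_eq_self K'.main S), ?_⟩
      have h3 : stepAux (cond (f v) q₁ q₂) v S = stepAux (branch f q₁ q₂) v S := by
        simp only [stepAux]; cases f v <;> rfl
      rw [h3]; exact h2
    | goto f =>
      exact ⟨M (f v), v, S, Prod.ext rfl (Function.update_eq_self K'.main S), h2.tail rfl⟩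
    | halt =>
      -- A reached `halt` would be a halted configuration of the machine, contrary to divergence.
      refine absurd ?_ h
      exact Part.dom_iff_mem.2 ⟨_, StateTransition.mem_eval.2 ⟨h2, rfl⟩⟩

/-- The labels that can be reached from a set of labels that supports the machine. -/
noncomputable def labels [Fintype σ] (F : Finset L) : Finset (Label L σ) :=
  open scoped Classical in
  ((F.biUnion fun l => Turing.TM2.stmts₁ (M l)) ×ˢ Finset.univ).disjSum Finset.univ

theorem nxt_mem_labels [Fintype σ] {F : Finset L}
    (hF : ∀ l ∈ F, Turing.TM2.SupportsStmt F (M l)) :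
    ∀ l ∈ labels M F, ∀ d, (machine M).nxt l d ∈ labels M F := by
  rintro (⟨q, v⟩ | l) hl d
  · simp only [labels, Finset.inl_mem_disjSum, Finset.mem_product, Finset.mem_biUnion,
      Finset.mem_univ, and_true] at hl
    obtain ⟨l, hl, hq⟩ := hl
    have hs := Turing.TM2.stmts₁_supportsStmt_mono hq (hF l hl)
    have key : ∀ q' v', q' ∈ Turing.TM2.stmts₁ q →
        (Sum.inl (q', v') : Label L σ) ∈ labels M F := fun q' v' h => by
      simp only [labels, Finset.inl_mem_disjSum, Finset.mem_product, Finset.mem_biUnion,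
        Finset.mem_univ, and_true]
      exact ⟨l, hl, Turing.TM2.stmts₁_trans hq h⟩
    cases q with
    | goto f =>
      simp only [labels, Finset.inl_mem_disjSum, Finset.mem_product, Finset.mem_biUnion,
        Finset.mem_univ, and_true, machine]
      exact ⟨f v, hs v, Turing.TM2.stmts₁_self⟩
    | halt => simp [labels, machine]
    | branch f q₁ q₂ =>
      refine key _ _ ?_
      cases f v <;> simp [Turing.TM2.stmts₁, Turing.TM2.stmts₁_self]
    | _ => exact key _ _ (by simp [Turing.TM2.stmts₁, Turing.TM2.stmts₁_self])
  · rcases l with k | _ | _ | _ | _ | _ | _ | _ <;> rcases d with _ | d <;>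
      first
        | (simp [labels, machine]; done)
        | (cases k <;> simp [labels, machine])

end

/-! ### Clearing the stacks and the doubling loop -/

section

variable {L σ : Type} (M : L → Turing.TM2.Stmt (fun _ : K' => Γ') L σ)

/-- The stacks with `m` and `r` symbols in `main` and `rev`, and the others empty. -/
def loopStacks (m r : ℕ) : K' → List Γ' :=
  K'.elim (.replicate m .cons) (.replicate r .cons) [] []

theorem machine_path_clear (k : K') (S : K' → List Γ') :
    ∃ n, (machine M).Path n (.inr (.clear k), S)
      ((machine M).nxt (.inr (.clear k)) none, Function.update S k []) := by
  generalize hL : S k = A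
  induction A generalizing S with
  | nil =>
    refine ⟨1, .head (machine_actAt_ne_halve M (by simp)) ?_⟩
    have : (machine M).step (.inr (.clear k), S) =
        ((machine M).nxt (.inr (.clear k)) none, Function.update S k []) := by
      have h1 : (machine M).stk (.inr (.clear k)) = k := rfl
      simp only [Program.step, Program.top, Program.actAt, h1, hL]
      rfl
    rw [this]; exact .refl _
  | cons a A ih =>
    obtain ⟨n, h⟩ := ih (Function.update S k A) (Function.update_self ..)
    rw [Function.update_idem] at h
    refine ⟨n + 1, .head (machine_actAt_ne_halve M (by simp)) ?_⟩
    have : (machine M).step (.inr (.clear k), S) =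
        (.inr (.clear k), Function.update S k A) := by
      have h1 : (machine M).stk (.inr (.clear k)) = k := rfl
      simp only [Program.step, Program.top, Program.actAt, h1, hL]
      rfl
    rw [this]; exact h

theorem Program.Path.single {Λ : Type} {P : Program Λ} {c : Config Λ} (hc : P.actAt c ≠ .halve) :
    P.Path 1 c (P.step c) := .head hc (.refl _)

theorem machine_path_start (S : K' → List Γ') :
    ∃ n, (machine M).Path n (.inr (.clear .main), S) (.inr .take, loopStacks 1 0) := by
  obtain ⟨n₁, h₁⟩ := machine_path_clear M .main S
  obtain ⟨n₂, h₂⟩ := machine_path_clear M .rev (Function.update S .main [])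
  obtain ⟨n₃, h₃⟩ := machine_path_clear M .aux (Function.update (Function.update S .main []) .rev [])
  obtain ⟨n₄, h₄⟩ := machine_path_clear M .stack
    (Function.update (Function.update (Function.update S .main []) .rev []) .aux [])
  refine ⟨_, (((h₁.trans h₂).trans h₃).trans h₄).trans ?_ (n := 1)⟩
  have e : Function.update (Function.update (Function.update (Function.update S .main []) .rev [])
      .aux []) .stack [] = fun _ => ([] : List Γ') := by
    ext k; cases k <;> simp
  rw [e]
  have : (machine M).step (.inr .start, fun _ => []) = (.inr .take, loopStacks 1 0) := by
    refine Prod.ext rfl (funext fun k => ?_)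
    cases k <;> simp [Program.step, loopStacks, machine, Program.actAt, Act.apply]
  rw [← this]
  exact .single (machine_actAt_ne_halve M (by simp [machine]))

theorem machine_step_take (m r : ℕ) : (machine M).step (.inr .take, loopStacks (m + 1) r) =
    (.inr .put₁, loopStacks m r) := by
  refine Prod.ext rfl (funext fun k => ?_)
  cases k <;> simp [Program.step, loopStacks, machine, Program.actAt, Act.apply]

theorem machine_step_take_zero (r : ℕ) : (machine M).step (.inr .take, loopStacks 0 r) =
    (.inr .shrink, loopStacks 0 r) := by
  refine Prod.ext rfl (funext fun k => ?_)
  cases k <;> simp [Program.step, loopStacks, machine, Program.actAt, Act.apply]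

theorem machine_step_put₁ (m r : ℕ) : (machine M).step (.inr .put₁, loopStacks m r) =
    (.inr .put₂, loopStacks m (r + 1)) := by
  refine Prod.ext rfl (funext fun k => ?_)
  cases k <;> simp [Program.step, loopStacks, machine, Program.actAt, Act.apply, List.replicate_succ]

theorem machine_step_put₂ (m r : ℕ) : (machine M).step (.inr .put₂, loopStacks m r) =
    (.inr .take, loopStacks m (r + 1)) := by
  refine Prod.ext rfl (funext fun k => ?_)
  cases k <;> simp [Program.step, loopStacks, machine, Program.actAt, Act.apply, List.replicate_succ]

theorem machine_step_shrink (m r : ℕ) : (machine M).step (.inr .shrink, loopStacks m r) =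
    (.inr .back, loopStacks m r) := by
  refine Prod.ext rfl (funext fun k => ?_)
  cases k <;> simp [Program.step, loopStacks, machine, Program.actAt, Act.apply]

theorem machine_step_back (m r : ℕ) : (machine M).step (.inr .back, loopStacks m (r + 1)) =
    (.inr .put, loopStacks m r) := by
  refine Prod.ext rfl (funext fun k => ?_)
  cases k <;> simp [Program.step, loopStacks, machine, Program.actAt, Act.apply]

theorem machine_step_back_zero (m : ℕ) : (machine M).step (.inr .back, loopStacks m 0) =
    (.inr .take, loopStacks m 0) := by
  refine Prod.ext rfl (funext fun k => ?_)
  cases k <;> simp [Program.step, loopStacks, machine, Program.actAt, Act.apply]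

theorem machine_step_put (m r : ℕ) : (machine M).step (.inr .put, loopStacks m r) =
    (.inr .back, loopStacks (m + 1) r) := by
  refine Prod.ext rfl (funext fun k => ?_)
  cases k <;> simp [Program.step, loopStacks, machine, Program.actAt, Act.apply, List.replicate_succ]

/-- Each symbol taken from `main` puts two on `rev`. The bound `m ≤ n` later becomes the lower bound
`m * s` for the duration of a round. -/
theorem machine_path_take (m r : ℕ) : ∃ n, m ≤ n ∧
    (machine M).Path n (.inr .take, loopStacks m r) (.inr .shrink, loopStacks 0 (2 * m + r)) := by
  induction m generalizing r with
  | zero =>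
    refine ⟨1, Nat.zero_le _, ?_⟩
    rw [Nat.mul_zero, Nat.zero_add, ← machine_step_take_zero M]
    exact .single (machine_actAt_ne_halve M (by simp))
  | succ m ih =>
    obtain ⟨n, hn, h⟩ := ih (r + 2)
    refine ⟨n + 1 + 1 + 1, by omega, .head (machine_actAt_ne_halve M (by simp)) ?_⟩
    rw [machine_step_take]
    refine .head (machine_actAt_ne_halve M (by simp)) ?_
    rw [machine_step_put₁]
    refine .head (machine_actAt_ne_halve M (by simp)) ?_
    rw [machine_step_put₂]
    rwa [show 2 * (m + 1) + r = 2 * m + (r + 2) by ring]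

theorem machine_path_back (m r : ℕ) : ∃ n,
    (machine M).Path n (.inr .back, loopStacks m r) (.inr .take, loopStacks (m + r) 0) := by
  induction r generalizing m with
  | zero =>
    refine ⟨1, ?_⟩
    rw [Nat.add_zero, ← machine_step_back_zero M]
    exact .single (machine_actAt_ne_halve M (by simp))
  | succ r ih =>
    obtain ⟨n, h⟩ := ih (m + 1)
    refine ⟨n + 1 + 1, .head (machine_actAt_ne_halve M (by simp)) ?_⟩
    rw [machine_step_back]
    refine .head (machine_actAt_ne_halve M (by simp)) ?_
    rw [machine_step_put]
    rwa [show m + (r + 1) = m + 1 + r by ring]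

end

/-! ### Stability and the behaviour of the scale -/

namespace Program

variable {Λ : Type} [DecidableEq Λ] [Fintype Λ] (P : Program Λ)

/-- The number of coordinates of the fluid model. -/
abbrev dim (Λ : Type) [DecidableEq Λ] [Fintype Λ] : ℕ := Fintype.card (Coord Λ)

/-- A numbering of the coordinates of the fluid model. -/
noncomputable abbrev index (Λ : Type) [DecidableEq Λ] [Fintype Λ] : Coord Λ ≃ Fin (dim Λ) :=
  Fintype.equivFin _

/-- The reflection matrix with numbered coordinates. -/
noncomputable def finMatrix : Matrix (Fin (dim Λ)) (Fin (dim Λ)) ℝ :=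
  P.matrix.submatrix (index Λ).symm (index Λ).symm

theorem finMatrix_diag (i : Fin (dim Λ)) : P.finMatrix i i = 1 := P.matrix_diag _

theorem isCompletelyS_finMatrix : IsCompletelyS P.finMatrix :=
  isCompletelyS_of_rank (fun i => rank ((index Λ).symm i)) P.finMatrix_diag
    fun _ _ h => P.rank_lt_of_neg _ _ h

/-- If the scale is never halved, then the fluid model is not stable. -/
theorem not_isStable {s : ℝ} (hs : 0 < s) (c : Config Λ)
    (h : ∀ n, P.actAt (P.step^[n] c) ≠ .halve) :
    ¬ IsStable (state s c ∘ (index Λ).symm) (fun _ => -1) P.finMatrix := by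
  have hrun : ∀ n, ∃ T, s ≤ T ∧ Run P.finMatrix (1000 * s) (10 * 1)
      (state s (P.step^[n] c) ∘ (index Λ).symm) T
      (state s (P.step^[n + 1] c) ∘ (index Λ).symm) := by
    intro n
    rw [Function.iterate_succ_apply']
    obtain ⟨T, hT, hr⟩ := (Path.single (h n)).run hs le_rfl
    exact ⟨T, by simpa using hT, hr.reindex _⟩
  choose T hT hr using hrun
  obtain ⟨y, z, hyz, hz⟩ := exists_isSolution_of_runs P.finMatrix_diag hs hT
    (u := fun n => state s (P.step^[n] c) ∘ (index Λ).symm) hr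
  intro hst
  -- At every arrival in a node all coordinates `B` equal the scale, whatever the configuration.
  have h1 := (tendsto_pi_nhds.1 (hst y z hyz)) (index Λ (.B (.fst c.1)))
  have h2 := (h1.eventually (gt_mem_nhds (show (0 : Fin (dim Λ) → ℝ) _ < s from hs)))
  obtain ⟨t₀, ht₀⟩ := eventually_atTop.1 h2
  obtain ⟨n, -, t, ht, hzt⟩ := hz ⌈t₀⌉₊
  have h3 := ht₀ t ((Nat.le_ceil t₀).trans ht)
  rw [hzt] at h3
  simp [state, hub, assemble] at h3

/-- If the fluid model reaches a family of configurations `c m` such that `c m` is followed by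
`c (2 * m)` at half the scale, then it is stable. -/
theorem isStable {s : ℝ} (hs : 0 < s) {c₀ : Config Λ} {c : ℕ → Config Λ}
    (h₀ : ∃ n, P.Path n c₀ (c 1))
    (h : ∀ (m : ℕ) (σ : ℝ), 0 < σ → ∃ n T, m * σ ≤ T ∧
      Run P.matrix (1000 * σ) n (state σ (c m)) T (state (σ / 2) (c (2 * m)))) :
    IsStable (state s c₀ ∘ (index Λ).symm) (fun _ => -1) P.finMatrix := by
  intro y z hyz
  have hp := hyz.reflectedPath
  set Z : ℝ → Fin (dim Λ) → ℝ := fun t => z t.toNNReal with hZ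
  have hZ0 : Z 0 = state s c₀ ∘ (index Λ).symm := by
    have := hyz.eq_add 0
    rw [hyz.zero_y] at this
    simpa [hZ] using this
  -- from a configuration of the family on, the path is bounded by the scale
  have hbd : ∀ N : ℕ, ∀ (σ : ℝ) (m : ℕ) (t : ℝ), 0 < σ → s ≤ m * σ → 0 ≤ t →
      Z t = state σ (c m) ∘ (index Λ).symm → ∀ r ∈ Set.Icc t (t + N * s), ∀ i,
        Z r i ≤ 1000 * σ := by
    intro N
    induction N with
    | zero =>
      intro σ m t hσ _ ht hzt r hr i
      have : r = t := le_antisymm (by simpa using hr.2) hr.1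
      rw [this, hzt]
      exact state_le hσ _ _
    | succ N ih =>
      intro σ m t hσ hm ht hzt r hr i
      obtain ⟨n, T, hT, hrun⟩ := h m σ hσ
      obtain ⟨h1, h2⟩ := hp.eq_of_run P.finMatrix_diag (hrun.reindex _) ht hzt
      by_cases hrT : r ≤ t + T
      · exact h2 r ⟨hr.1, hrT⟩ i
      -- The product `m * σ` survives the passage to `(2 * m, σ / 2)`; so each round takes at least
      -- the time `s`, and `N` rounds cover an interval of length `N * s`.
      · have h3 := ih (σ / 2) (2 * m) (t + T) (by positivity) (by push_cast; linarith)
          (by linarith) h1 r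
          ⟨(not_le.1 hrT).le, hr.2.trans (by push_cast; linarith)⟩ i
        linarith
  have hreach : ∀ j : ℕ, ∃ t, 0 ≤ t ∧
      Z t = state (s / 2 ^ j) (c (2 ^ j)) ∘ (index Λ).symm := by
    intro j
    induction j with
    | zero =>
      obtain ⟨n, hn⟩ := h₀
      obtain ⟨T, hT, hrun⟩ := hn.run hs le_rfl
      have h1 := (hp.eq_of_run P.finMatrix_diag (hrun.reindex _) le_rfl hZ0).1
      exact ⟨0 + T, by rw [zero_add]; exact le_trans (by positivity) hT, by simpa using h1⟩
    | succ j ih =>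
      obtain ⟨t, ht, hzt⟩ := ih
      obtain ⟨n, T, hT, hrun⟩ := h (2 ^ j) (s / 2 ^ j) (by positivity)
      have h1 := (hp.eq_of_run P.finMatrix_diag (hrun.reindex _) ht hzt).1
      refine ⟨t + T, add_nonneg ht (le_trans (by positivity) hT), ?_⟩
      rw [h1, pow_succ', pow_succ', div_div, mul_comm (2 ^ j : ℝ) 2]
  refine tendsto_pi_nhds.2 fun i => ?_
  rw [Metric.tendsto_atTop]
  intro ε hε
  obtain ⟨j, hj⟩ : ∃ j : ℕ, 1000 * s / ε < 2 ^ j := pow_unbounded_of_one_lt _ one_lt_two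
  obtain ⟨t, ht, hzt⟩ := hreach j
  refine ⟨t.toNNReal, fun r hr => ?_⟩
  have hr' : t ≤ r := Real.toNNReal_le_iff_le_coe.1 hr
  obtain ⟨N, hN⟩ := exists_nat_ge (((r : ℝ) - t) / s)
  have h2 : (2 : ℝ) ^ j ≠ 0 := by positivity
  have h1 := hbd N (s / 2 ^ j) (2 ^ j) t (by positivity)
    (le_of_eq (by push_cast; field_simp)) ht hzt r
    ⟨hr', by rw [div_le_iff₀ hs] at hN; linarith⟩ i
  have h3 : Z r i = z r i := by simp [hZ]
  rw [h3] at h1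
  have h4 := hyz.nonneg_z r i
  rw [Pi.zero_apply, Real.dist_eq, sub_zero, abs_of_nonneg h4]
  refine h1.trans_lt ?_
  rw [div_lt_iff₀ hε] at hj
  rw [← mul_div_assoc, div_lt_iff₀ (by positivity)]
  linarith

end Program

/-! ### The fluid model of a machine with stacks -/

section

variable {L σ : Type} [Fintype σ] (M : L → Turing.TM2.Stmt (fun _ : K' => Γ') L σ)
  {F : Finset L} (hF : ∀ l ∈ F, Turing.TM2.SupportsStmt F (M l))

/-- The program of a machine, with finitely many labels. -/
noncomputable def finMachine : Program (labels M F) :=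
  (machine M).restrict (labels M F) (nxt_mem_labels M hF)

theorem inr_mem_labels (l : Loop) : (.inr l : Label L σ) ∈ labels M F := by simp [labels]

theorem inl_mem_labels {l : L} (hl : l ∈ F) (v : σ) :
    (.inl (M l, v) : Label L σ) ∈ labels M F := by
  simp only [labels, Finset.inl_mem_disjSum, Finset.mem_product, Finset.mem_biUnion,
    Finset.mem_univ, and_true]
  exact ⟨l, hl, Turing.TM2.stmts₁_self⟩

/-- The scale is halved when `main` has been emptied into `rev`, so the inspected stack is the only
nonempty one, as `run_step` demands. -/
theorem finMachine_run_loop [DecidableEq (labels M F)] (m : ℕ) {s : ℝ} (hs : 0 < s) :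
    ∃ n T, m * s ≤ T ∧ Run (finMachine M hF).matrix (1000 * s) n
      (Program.state s (⟨.inr .take, inr_mem_labels M _⟩, loopStacks m 0)) T
      (Program.state (s / 2) (⟨.inr .take, inr_mem_labels M _⟩, loopStacks (2 * m) 0)) := by
  obtain ⟨n₁, hn₁, h₁⟩ := machine_path_take M m 0
  obtain ⟨n₂, h₂⟩ := machine_path_back M 0 (2 * m)
  obtain ⟨h₁', p₁⟩ := h₁.restrict (hF := nxt_mem_labels M hF) (inr_mem_labels M _)
  obtain ⟨h₂', p₂⟩ := h₂.restrict (hF := nxt_mem_labels M hF) (inr_mem_labels M _)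
  obtain ⟨T₁, hT₁, r₁⟩ := p₁.run hs le_rfl
  obtain ⟨T, hT, r⟩ := (finMachine M hF).run_step hs le_rfl
    (⟨.inr .shrink, h₁'⟩, loopStacks 0 (2 * m)) (fun _ k hk => by
      have : k ≠ .rev := hk
      cases k <;> simp_all [loopStacks])
  obtain ⟨T₂, hT₂, r₂⟩ := p₂.run (s := s / 2) (B := 1000 * s) (by positivity) (by linarith)
  have e : (finMachine M hF).step (⟨.inr .shrink, h₁'⟩, loopStacks 0 (2 * m)) =
      (⟨.inr .back, inr_mem_labels M _⟩, loopStacks 0 (2 * m)) := by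
    have := machine_step_shrink M 0 (2 * m)
    exact Prod.ext (Subtype.ext (congrArg Prod.fst this :)) (congrArg Prod.snd this :)
  have e' : (((finMachine M hF).actAt (⟨.inr .shrink, h₁'⟩, loopStacks 0 (2 * m))).scale : ℝ) * s =
      s / 2 := by
    have : (finMachine M hF).actAt (⟨.inr .shrink, h₁'⟩, loopStacks 0 (2 * m)) = .halve := rfl
    rw [this]
    simp only [Act.scale]
    push_cast
    ring
  rw [e, e'] at r
  simp only [zero_add] at r₂
  refine ⟨_, _, ?_, (r₁.trans r).trans r₂⟩
  have h3 : (m : ℝ) * s ≤ n₁ * s := mul_le_mul_of_nonneg_right (by exact_mod_cast hn₁) hs.le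
  have h4 : 0 ≤ T₂ := r₂.time_nonneg
  linarith

/-- The fluid model of a machine is stable if and only if the machine halts. -/
theorem isStable_finMachine_iff [DecidableEq (labels M F)] {s : ℝ} (hs : 0 < s) {l : L}
    (hl : l ∈ F) (v : σ) (S : K' → List Γ') :
    IsStable
      (Program.state s ((⟨.inl (M l, v), inl_mem_labels M hl v⟩, S) : Config (labels M F)) ∘
        (Program.index (labels M F)).symm) (fun _ => -1) (finMachine M hF).finMatrix ↔
      (StateTransition.eval (Turing.TM2.step M) ⟨some l, v, S⟩).Dom := by
  constructor
  · contrapose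
    intro h
    refine Program.not_isStable _ hs _ fun n => ?_
    have hsemi : Function.Semiconj
        (fun c : Config (labels M F) => ((c.1 : Label L σ), c.2))
        (finMachine M hF).step (machine M).step := fun _ => rfl
    obtain ⟨q, v', S', h1, -⟩ := machine_iterate M (a := ⟨some l, v, S⟩) (by simp) h n
    have h2 := hsemi.iterate_right n (⟨.inl (M l, v), inl_mem_labels M hl v⟩, S)
    have h3 := h2.trans h1
    have h4 : (machine M).actAt (.inl (q, v'), S') ≠ .halve :=
      machine_actAt_ne_halve M (by simp)
    exact fun h5 => h4 ((congrArg (machine M).actAt h3).symm.trans h5)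
  · intro h
    obtain ⟨b, hb⟩ := Part.dom_iff_mem.1 h
    obtain ⟨h1, h2⟩ := StateTransition.mem_eval.1 hb
    obtain ⟨n, hn⟩ := machine_path_of_reaches M h1
    obtain ⟨_ | l', v', S'⟩ := b
    · obtain ⟨n', hn'⟩ := machine_path_start M S'
      obtain ⟨_, p⟩ := (hn.trans hn').restrict (hF := nxt_mem_labels M hF)
        (inl_mem_labels M hl v)
      exact Program.isStable _ hs ⟨_, p⟩
        (c := fun m => (⟨.inr .take, inr_mem_labels M _⟩, loopStacks m 0))
        fun m σ hσ => finMachine_run_loop M hF m hσ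
    · simp at h2

end

/-! ### Computability of the reduction -/

/-- The integer with the decimal digits of the stack that contains the unary number `n`. -/
def stackValue (n : ℕ) : ℕ := (4 * 10 ^ (n + 1) - 22) / 9

/-- The digits of `bit1` and `cons` are `4` and `2`, and `9 * 4…42 + 22 = 4 * 10 ^ (n + 1)`. The
scale `10 ^ (n + 1)` is what makes the initial state integral. -/
theorem stackValue_eq (n : ℕ) :
    (stackValue n : ℝ) = 10 ^ (n + 1) * enc (List.replicate n .bit1 ++ [.cons]) := by
  have h : ∀ n : ℕ, 9 * ((10 : ℝ) ^ (n + 1) * enc (List.replicate n .bit1 ++ [.cons])) + 22 =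
      4 * 10 ^ (n + 1) := by
    intro n
    induction n with
    | zero => norm_num [enc, digit]
    | succ n ih =>
      have h1 : enc (List.replicate (n + 1) .bit1 ++ [.cons]) =
          (4 + enc (List.replicate n .bit1 ++ [.cons])) / 10 := by
        simp [List.replicate_succ, enc, digit]
      rw [h1, pow_succ (10 : ℝ) (n + 1)]
      linear_combination ih
  have h9 : ∃ k, 4 * 10 ^ (n + 1) - 22 = 9 * k ∧ 22 ≤ 4 * 10 ^ (n + 1) := by
    induction n with
    | zero => exact ⟨2, by norm_num⟩
    | succ n ih =>
      obtain ⟨k, h1, h2⟩ := ih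
      refine ⟨k + 4 * 10 ^ (n + 1), ?_⟩
      rw [pow_succ 10 (n + 1)]
      omega
  obtain ⟨k, h1, h2⟩ := h9
  have h3 : stackValue n = k := by rw [stackValue, h1]; omega
  have h4 : 4 * 10 ^ (n + 1) = 9 * k + 22 := by omega
  have h5 : (4 : ℝ) * 10 ^ (n + 1) = 9 * k + 22 := by exact_mod_cast h4
  rw [h3]
  linarith [h n]

/-- The initial state of the fluid model with the scale `10 ^ (n + 1)`. -/
def initialState {Λ : Type} [DecidableEq Λ] (l : Λ) (n : ℕ) : Coord Λ → ℕ
  | .A q => if q = .fst l then 0 else 10 ^ (n + 1)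
  | .B _ => 10 ^ (n + 1)
  | .M _ => 200 * 10 ^ (n + 1)
  | .X (some .main) => stackValue n + 2 * 10 ^ (n + 1)
  | .X _ => 2 * 10 ^ (n + 1)
  | .W => 0

theorem initialState_eq {Λ : Type} [DecidableEq Λ] (l : Λ) (n : ℕ) (i : Coord Λ) :
    (initialState l n i : ℝ) = Program.state (10 ^ (n + 1))
      (l, K'.elim (List.replicate n .bit1 ++ [.cons]) [] [] []) i := by
  rcases i with q | q | m | (_ | k) | _
  · simp [initialState, Program.state, hub, assemble]
  · simp [initialState, Program.state, hub, assemble]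
  · simp [initialState, Program.state, hub, assemble]
  · simp [initialState, Program.state, hub, assemble, Program.regs]
  · cases k <;> simp [initialState, Program.state, hub, assemble, Program.regs, enc, stackValue_eq]
  · simp [initialState, Program.state, hub, assemble]

/-- All binary digits of `2 ^ n - 1` are `1`; this gives the closed form for the stack and hence the
computability of `z₀`. -/
theorem trList_singleton (n : ℕ) : Turing.PartrecToTM2.trList [2 ^ n - 1] =
    List.replicate n .bit1 ++ [.cons] := by
  have h : ∀ n : ℕ, Turing.PartrecToTM2.trNat (2 ^ n - 1) = List.replicate n .bit1 := by
    intro n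
    induction n with
    | zero => exact Turing.PartrecToTM2.trNat_zero
    | succ n ih =>
      have h1 : 2 ^ (n + 1) - 1 = (2 ^ n - 1) + (2 ^ n - 1) + 1 := by
        have := Nat.one_le_two_pow (n := n)
        rw [pow_succ]; omega
      rw [List.replicate_succ, ← ih, h1, Turing.PartrecToTM2.trNat, Turing.PartrecToTM2.trNat,
        Nat.cast_add, Nat.cast_add, Nat.cast_one, Num.bit1_of_bit1]
      cases ((2 ^ n - 1 : ℕ) : Num) <;> rfl
  rw [Turing.PartrecToTM2.trList, h]
  rfl

theorem primrec_pow : Primrec fun n : ℕ => 10 ^ (n + 1) :=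
  (Primrec.nat_iff.2 Nat.Primrec.pow : Primrec _).comp
    (Primrec₂.natPair.comp (Primrec.const 10) Primrec.succ) |>.of_eq fun n => by simp [Nat.unpaired]

theorem primrec_stackValue : Primrec stackValue :=
  Primrec.nat_div.comp (Primrec.nat_sub.comp
    (Primrec.nat_mul.comp (Primrec.const 4) primrec_pow) (Primrec.const 22)) (Primrec.const 9)

theorem primrec_initialState {Λ : Type} [DecidableEq Λ] (l : Λ) (i : Coord Λ) :
    Primrec fun n => initialState l n i := by
  have h := fun k => Primrec.nat_mul.comp (Primrec.const k) primrec_pow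
  rcases i with q | q | m | (_ | k) | _ <;> simp only [initialState]
  · split_ifs
    · exact Primrec.const 0
    · exact primrec_pow
  · exact primrec_pow
  · exact h 200
  · exact h 2
  · cases k
    · exact Primrec.nat_add.comp primrec_stackValue (h 2)
    all_goals exact h 2
  · exact Primrec.const 0

theorem primrec_encodeRat_natCast : Primrec fun n : ℕ => encodeRat (n : ℚ) := by
  have h : Primrec fun n : ℕ => (n : ℤ) :=
    -- The encoding of integers sends the nonnegative integer `n` to `2 * n`.
    Primrec.encode_iff.1 ((Primrec.nat_mul.comp (Primrec.const 2) Primrec.id).of_eq fun n => rfl)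
  exact (h.pair (Primrec.const 1)).of_eq fun n => by simp [encodeRat]

/-- A partial recursive function whose domain encodes the halting problem in unary numbers. -/
theorem exists_code_halting : ∃ C : Turing.ToPartrec.Code, ∀ c : Nat.Partrec.Code,
    (C.eval [2 ^ Encodable.encode c - 1]).Dom ↔ (c.eval 0).Dom := by
  -- Search for `n` with `m = 2 ^ n - 1`, then run the code number `n` on `0`; arguments of another
  -- form diverge.
  let g : ℕ →. ℕ := fun m =>
    (Nat.rfind (fun n => Part.some (decide (2 ^ n = m + 1)) : ℕ →. Bool)).bind fun n =>
      (Denumerable.ofNat Nat.Partrec.Code n).eval 0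
  have hg : Partrec g := by
    refine Partrec.bind (Partrec.rfind ?_) ?_
    · have h1 : Primrec fun n : ℕ => 2 ^ n :=
        (Primrec.nat_iff.2 Nat.Primrec.pow : Primrec _).comp
          (Primrec₂.natPair.comp (Primrec.const 2) Primrec.id) |>.of_eq fun n => by
            simp [Nat.unpaired]
      have h2 : PrimrecPred fun p : ℕ × ℕ => 2 ^ p.2 = p.1 + 1 :=
        Primrec.eq.comp (h1.comp Primrec.snd) (Primrec.succ.comp Primrec.fst)
      exact h2.decide.to_comp.partrec
    · exact Nat.Partrec.Code.eval_part.comp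
        ((Computable.ofNat Nat.Partrec.Code).comp Computable.snd) (Computable.const 0)
  have hv : ∀ n, g (2 ^ n - 1) = (Denumerable.ofNat Nat.Partrec.Code n).eval 0 := by
    intro n
    have h1 := Nat.one_le_two_pow (n := n)
    have h2 : n ∈ Nat.rfind (fun k => Part.some (decide (2 ^ k = 2 ^ n - 1 + 1)) : ℕ →. Bool) := by
      refine Nat.mem_rfind.2 ⟨by simp [Nat.sub_add_cancel h1], fun {m} hm => ?_⟩
      have := Nat.pow_lt_pow_right (a := 2) one_lt_two hm
      simp only [Part.mem_some_iff, Nat.sub_add_cancel h1]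
      exact (decide_eq_false this.ne).symm
    simp only [g, Part.eq_some_iff.2 h2, Part.bind_some]
  obtain ⟨C, hC⟩ := Turing.ToPartrec.Code.exists_code (Nat.Partrec'.part_iff₁.2 hg)
  refine ⟨C, fun c => ?_⟩
  have h1 := hC ⟨[2 ^ Encodable.encode c - 1], rfl⟩
  have h2 : List.Vector.head (⟨[2 ^ Encodable.encode c - 1], rfl⟩ : List.Vector ℕ 1) =
    2 ^ Encodable.encode c - 1 := rfl
  rw [h2, hv, Denumerable.ofNat_encode] at h1
  exact iff_of_eq (congrArg Part.Dom h1)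

/-- No partial recursive function decides the stability of fluid models. -/
theorem not_decidesStability {f : Input →. Bool} (hf : Partrec f) : ¬ DecidesStability f := by
  classical
  intro hdec
  obtain ⟨C, hC⟩ := exists_code_halting
  have hsupp := @Turing.PartrecToTM2.tr_supports C .halt
  have hl := hsupp.1
  have hF := hsupp.2
  set F := Turing.PartrecToTM2.codeSupp C .halt
  set l := Turing.PartrecToTM2.trNormal C .halt
  change l ∈ F at hl
  set Λ := labels Turing.PartrecToTM2.tr F
  set P : Program Λ := finMachine Turing.PartrecToTM2.tr hF
  let l₀ : Λ := ⟨.inl (Turing.PartrecToTM2.tr l, none), inl_mem_labels _ hl _⟩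
  let z₀ : ℕ → Fin (Program.dim Λ) → ℚ :=
    fun n i => (initialState l₀ n ((Program.index Λ).symm i) : ℕ)
  let R : Matrix (Fin (Program.dim Λ)) (Fin (Program.dim Λ)) ℚ :=
    P.matrixQ.submatrix (Program.index Λ).symm (Program.index Λ).symm
  have hR : (R.map fun q : ℚ => (q : ℝ)) = P.finMatrix := rfl
  let input : Nat.Partrec.Code → Input :=
    fun c => encodeModel (z₀ (Encodable.encode c)) (fun _ => -1) R
  have hinput : Computable input := by
    refine Computable.pair (Computable.list_ofFn fun i => ?_) (Computable.const _)
    exact (primrec_encodeRat_natCast.comp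
      ((primrec_initialState l₀ ((Program.index Λ).symm i)).comp Primrec.encode)).to_comp
  have hst : ∀ c : Nat.Partrec.Code,
      IsStable (fun i => (z₀ (Encodable.encode c) i : ℝ)) (fun _ => ((-1 : ℚ) : ℝ))
        (R.map fun q : ℚ => (q : ℝ)) ↔ (c.eval 0).Dom := by
    intro c
    have h1 : (fun i => (z₀ (Encodable.encode c) i : ℝ)) =
        Program.state (10 ^ (Encodable.encode c + 1))
          ((l₀, Turing.PartrecToTM2.K'.elim (Turing.PartrecToTM2.trList [2 ^ Encodable.encode c - 1]) [] [] []) :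
            Config Λ) ∘ (Program.index Λ).symm := by
      funext i
      rw [trList_singleton, Function.comp_apply, ← initialState_eq]
      simp [z₀]
    have h2 : (fun _ : Fin (Program.dim Λ) => ((-1 : ℚ) : ℝ)) = fun _ => -1 := by simp
    rw [h1, h2, hR, ← hC c]
    refine (isStable_finMachine_iff Turing.PartrecToTM2.tr hF (by positivity) hl none _).trans ?_
    have h3 := Turing.PartrecToTM2.tr_eval C [2 ^ Encodable.encode c - 1]
    exact (iff_of_eq (congrArg Part.Dom h3))
  have hpos : 1 ≤ Program.dim Λ := Fintype.card_pos_iff.2 ⟨.W⟩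
  -- Composing `f` with the reduction would compute the characteristic function of halting on `0`;
  -- `f` is only queried on admissible models, where it must answer.
  refine ComputablePred.halting_problem 0 ⟨inferInstance, ?_⟩
  refine (hf.comp hinput).of_eq fun c => ?_
  have h := hdec (Program.dim Λ) (z₀ (Encodable.encode c)) (fun _ => -1) R hpos
    (fun i => Nat.cast_nonneg _) (by rw [hR]; exact P.isCompletelyS_finMatrix)
  rw [hst c] at h
  refine Part.eq_some_iff.2 ?_
  by_cases hc : (c.eval 0).Dom
  · simpa [hc] using h.1 hc
  · simpa [hc] using h.2 hc

end Skorokhod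

theorem mainTheorem1 :
    ¬ ∃ f : Skorokhod.Input →. Bool, Partrec f ∧ Skorokhod.DecidesStability f := by
  rintro ⟨f, hf, hdec⟩
  exact Skorokhod.not_decidesStability hf hdec
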